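/- **Notation.** All functions are real-valued and $2\pi$-periodic on $\mathbb R$. For $1\le p<\infty$, $\|g\|_p=\big(\int_0^{2\pi}|g(t)|^p\,dt\big)^{1/p}$ and $L_p$ is the corresponding space; $\|g\|_C=\max_t|g(t)|$ for continuous $g$. For $\alpha>0$, $0<r<1$, $\beta\in\mathbb R$ let $$P_{\alpha,r,\beta}(t)=\sum_{k=1}^{\infty}e^{-\alpha k^r}\cos\Big(kt-\frac{\beta\pi}{2}\Big).$$ $C^{\alpha,r}_\beta L_p$ is the set of functions $f$ that can be written, for some $a_0\in\mathbb R$ and some $\varphi\in L_p$ with $\int_{-\pi}^{\pi}\varphi=0$, as $$f(x)=\frac{a_0}{2}+\frac1\pi\int_{-\pi}^{\pi}P_{\alpha,r,\beta}(x-t)\varphi(t)\,dt\qquad(x\in\mathbb R);$$ the function $\varphi=:f^{\alpha,r}_\beta$ is the generalized derivative of $f$. Every such $f$ is continuous. $S_{n-1}(f)$ is the partial Fourier sum of $f$ of order $n-1$, $E_n(\varphi)_{L_p}=\inf_{t_{n-1}}\|\varphi-t_{n-1}\|_p$ is the infimum over trigonometric polynomials $t_{n-1}$ of degree at most $n-1$,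 and $F(a,b;c;z)=\sum_{k\ge0}\frac{(a)_k(b)_k}{(c)_k}\frac{z^k}{k!}$, $(x)_k=x(x+1)\cdots(x+k-1)$, is the Gauss hypergeometric function. For $1\le p<\infty$ let $n_0(\alpha,r,p)$ be the smallest positive integer $n$ such that $$\frac1{\alpha r}\frac1{n^r}+\frac{\alpha r\,p}{n^{1-r}}\le\begin{cases}\frac1{14},&p=1,\\ \frac{1}{(3\pi)^3}\cdot\frac{p-1}{p},&1<p<\infty.\end{cases}$$ **Theorem 1.** Let $0<r<1$, $\alpha>0$, $\beta\in\mathbb R$. There are real numbers $\gamma_{n,p}=\gamma_{n,p}(\alpha,r,\beta)$, independent of $f$, with $|\gamma_{n,p}|\le(14\pi)^2$, such that the following holds. If $1<p<\infty$, $\frac1p+\frac1{p'}=1$, then for all positive integers $n\ge n_0(\alpha,r,p)$ and all $f\in C^{\alpha,r}_\beta L_p$, $$\|f-S_{n-1}(f)\|_C\le e^{-\alpha n^r}n^{\frac{1-r}{p}}\bigg(\frac{\|\cos t\|_{p'}}{\pi^{1+\frac1{p'}}(\alpha r)^{\frac1p}}F^{\frac1{p'}}\Big(\frac12,\frac{3-p'}2;\frac32;1\Big)+\gamma_{n,p}\Big(\Big(1+\frac{(\alpha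 r)^{\frac{p'-1}{p}}}{p'-1}\Big)\frac1{n^{\frac{1-r}{p}}}+\frac{p^{\frac1{p'}}}{(\alpha r)^{1+\frac1p}}\frac1{n^r}\Big)\bigg)E_n(f^{\alpha,r}_\beta)_{L_p}.$$ If $p=1$, then for all positive integers $n\ge n_0(\alpha,r,1)$ and all $f\in C^{\alpha,r}_\beta L_1$, $$\|f-S_{n-1}(f)\|_C\le e^{-\alpha n^r}n^{1-r}\Big(\frac1{\pi\alpha r}+\gamma_{n,1}\Big(\frac1{(\alpha r)^2}\frac1{n^r}+\frac1{n^{1-r}}\Big)\Big)E_n(f^{\alpha,r}_\beta)_{L_1}.$$ -/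

import Mathlib

open Real MeasureTheory

noncomputable section

namespace GenPoisson

/-- The generalized Poisson kernel `P_{α,r,β}(t) = ∑_{k ≥ 1} e^{-α k^r} cos (k t - β π / 2)`. -/
def kernel (α r β t : ℝ) : ℝ :=
  ∑' k : ℕ, exp (-α * ((k : ℝ) + 1) ^ r) * cos (((k : ℝ) + 1) * t - β * π / 2)

/-- The space `L_p`, `1 ≤ p < ∞`: real `2π`-periodic functions that are measurable (up to null sets)
and whose `p`-th power is summable over a period. -/
def MemLpPer (p : ℝ) (φ : ℝ → ℝ) : Prop :=
  Function.Periodic φ (2 * π) ∧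
    MemLp φ (ENNReal.ofReal p) (volume.restrict (Set.Ico 0 (2 * π)))

/-- The norm `‖g‖_p = (∫_0^{2π} |g(t)|^p dt)^{1/p}`. -/
def lpNormPer (p : ℝ) (g : ℝ → ℝ) : ℝ :=
  (∫ t in (0 : ℝ)..(2 * π), |g t| ^ p) ^ (1 / p)

/-- The uniform norm `‖g‖_C` (for a continuous `2π`-periodic `g`). -/
def uniformNorm (g : ℝ → ℝ) : ℝ := ⨆ t : ℝ, |g t|

/-- `IsGenDeriv α r β p f φ`: the function `f` belongs to `C^{α,r}_β L_p` and `φ = f^{α,r}_β` is its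
generalized derivative, i.e. `φ ∈ L_p`, `φ ⊥ 1`, and for some real `a₀` and all real `x`,
`f(x) = a₀/2 + (1/π) ∫_{-π}^{π} P_{α,r,β}(x - t) φ(t) dt`. -/
def IsGenDeriv (α r β p : ℝ) (f φ : ℝ → ℝ) : Prop :=
  MemLpPer p φ ∧ (∫ t in (-π)..π, φ t) = 0 ∧
    ∃ a₀ : ℝ, ∀ x : ℝ,
      f x = a₀ / 2 + (1 / π) * ∫ t in (-π)..π, kernel α r β (x - t) * φ t

/-- The trigonometric polynomial `a_0/2 + ∑_{k=1}^m (a_k cos kx + b_k sin kx)`. -/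
def trigPoly (m : ℕ) (a b : ℕ → ℝ) (x : ℝ) : ℝ :=
  a 0 / 2 + ∑ k ∈ Finset.Icc 1 m, (a k * cos (k * x) + b k * sin (k * x))

/-- The Fourier coefficient `a_k(f)`. -/
def cosCoeff (f : ℝ → ℝ) (k : ℕ) : ℝ := (1 / π) * ∫ t in (-π)..π, f t * cos (k * t)

/-- The Fourier coefficient `b_k(f)`. -/
def sinCoeff (f : ℝ → ℝ) (k : ℕ) : ℝ := (1 / π) * ∫ t in (-π)..π, f t * sin (k * t)

/-- The partial Fourier sum `S_m(f; x)` of order `m`. -/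
def fourierSum (m : ℕ) (f : ℝ → ℝ) (x : ℝ) : ℝ := trigPoly m (cosCoeff f) (sinCoeff f) x

/-- The best approximation `E_n(φ)_{L_p}` of `φ` in `L_p` by trigonometric polynomials of degree at
most `n - 1` (used for `n ≥ 1`). -/
def bestApprox (n : ℕ) (p : ℝ) (φ : ℝ → ℝ) : ℝ :=
  sInf {e : ℝ | ∃ a b : ℕ → ℝ, e = lpNormPer p (fun x => φ x - trigPoly (n - 1) a b x)}

/-- The number `n₀(α,r,p)`, `1 ≤ p < ∞`: the smallest integer `n ≥ 1` with
`1/(α r n^r) + α r p / n^{1-r} ≤ 1/14` if `p = 1`, and `≤ (3π)^{-3} (p-1)/p` if `p > 1`. -/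
def n₀ (α r p : ℝ) : ℕ :=
  sInf {n : ℕ | 1 ≤ n ∧
    1 / (α * r) * (1 / (n : ℝ) ^ r) + α * r * p / (n : ℝ) ^ (1 - r) ≤
      if p = 1 then 1 / 14 else 1 / (3 * π) ^ 3 * ((p - 1) / p)}

end GenPoisson

end

noncomputable section

namespace GenPoisson

/-! The deviation `f - S_{n-1}(f)` is `1/π` times the convolution of the kernel tail `∑_{k ≥ n}`
with `φ`. The tail is orthogonal to polynomials of degree at most `n - 1`, so `φ` may be replaced by
`φ - t_{n-1}`. Hölder's inequality and the infimum over `t_{n-1}` reduce everything to the `L_{p'}`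
norm of the tail (its sup norm if `p = 1`).

Write the tail as `e^{-α n^r} Re (c e^{int} K(t))` with `|c| = 1` and `K(t) = ∑ a_j e^{ijt}`, and
put `l = α r n^{r-1}`, `δ = 1/(α r n^r) = 1/(n l)`. Concavity of `x^r` gives `a_{j+1} ≥ e^{-l} a_j`,
so `a_j` dominates `e^{-lj}`, while an integral comparison shows that `∑ a_j` is only slightly
larger than `1/l`. Hence `K` is close to `1/(1 - e^{-l+it})`, and so to the pole `1/(l - it)`: the
error is a small multiple of the pole plus a constant (`norm_tailSum_sub_pole_le`).

For the pole the oscillating factor is averaged out. Some phase shift of `e^{int} · pole` has real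
part of `L_q` norm at most the phase average `‖cos‖_q (2π)^{-1/q} ‖pole‖_q`; a translation by at
most `2π/n` realizes that phase and changes the pole by a relative amount at most `2πδ`
(`eLpNorm_re_mul_pole_le`). Finally `‖pole‖_q` over the line is a Gauss hypergeometric value
(`integral_norm_pole_rpow`), which yields the main term.

Only an upper bound is claimed, so `γ` can be the constant `(14π)^2`, and for `p = 1` the bound `∑
a_j` suffices. -/

/-! ### Sums of `e^{-α k^r}` by comparison with an integral -/

theorem rpow_succ_sub_le {r x : ℝ} (hr0 : 0 < r) (hr1 : r < 1) (hx : 0 < x) :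
    (x + 1) ^ r - x ^ r ≤ r * x ^ (r - 1) := by
  have h1 : x + 1 = x * (1 + 1 / x) := by field_simp
  have h2 := rpow_one_add_le_one_add_mul_self (s := 1 / x)
    (by linarith [one_div_pos.mpr hx]) hr0.le hr1.le
  have h3 : x ^ (r - 1) = x ^ r / x := by rw [rpow_sub_one hx.ne']
  rw [h1, mul_rpow hx.le (by positivity), h3]
  have := mul_le_mul_of_nonneg_left h2 (rpow_nonneg hx.le r)
  calc _ ≤ x ^ r * (1 + r * (1 / x)) - x ^ r := by linarith
    _ = _ := by ring

/-- Increments of `x^r` are controlled by the derivative at an earlier point. -/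
theorem rpow_succ_sub_le_of_le {r x m : ℝ} (hr0 : 0 < r) (hr1 : r < 1) (hm : 0 < m) (hx : m ≤ x) :
    (x + 1) ^ r - x ^ r ≤ r * m ^ (r - 1) := by
  refine (rpow_succ_sub_le hr0 hr1 (hm.trans_le hx)).trans ?_
  exact mul_le_mul_of_nonneg_left (rpow_le_rpow_of_nonpos hm hx (by linarith)) hr0.le

/-- The tail majorant `t^{1-r} e^{-α t^r}`. -/
def tailMajorant (α r t : ℝ) : ℝ := t ^ (1 - r) * exp (-α * t ^ r)

theorem hasDerivAt_tailMajorant (α r : ℝ) {t : ℝ} (ht : 0 < t) :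
    HasDerivAt (tailMajorant α r)
      (((1 - r) * t ^ (-r) - α * r) * exp (-α * t ^ r)) t := by
  have h1 : HasDerivAt (fun t : ℝ => t ^ (1 - r)) ((1 - r) * t ^ (1 - r - 1)) t :=
    hasDerivAt_rpow_const (Or.inl ht.ne')
  have h2 : HasDerivAt (fun t : ℝ => t ^ r) (r * t ^ (r - 1)) t :=
    hasDerivAt_rpow_const (Or.inl ht.ne')
  have h3 := h1.mul ((h2.const_mul (-α)).exp)
  refine HasDerivAt.congr_deriv (f := tailMajorant α r) h3 ?_
  have e1 : (1 : ℝ) - r - 1 = -r := by ring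
  have e2 : t ^ (1 - r) * t ^ (r - 1) = 1 := by
    rw [← rpow_add ht]; simp
  rw [e1]
  linear_combination (-α * r * exp (-α * t ^ r)) * e2

/-- Minus the derivative of the majorant is `(α r - (1-r) t^{-r}) e^{-α t^r}`, which for `t ≥ m` is
at least `α r - m^{-r}` times the exponential. The mean value theorem turns this into a bound for
one term by a difference that telescopes. -/
theorem exp_le_tailMajorant_sub {α r x m : ℝ} (hr0 : 0 < r) (hr1 : r < 1) (hα : 0 < α)
    (hm : 0 < m) (hx : m ≤ x) (hδ : 1 / (α * r * m ^ r) < 1) :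
    exp (-α * (x + 1) ^ r) * (α * r * (1 - 1 / (α * r * m ^ r))) ≤
      tailMajorant α r x - tailMajorant α r (x + 1) := by
  have hx0 : 0 < x := hm.trans_le hx
  obtain ⟨c, hc, hc'⟩ := exists_hasDerivAt_eq_slope (tailMajorant α r)
    (fun t => ((1 - r) * t ^ (-r) - α * r) * exp (-α * t ^ r)) (a := x) (b := x + 1) (by linarith)
    (fun t ht => (hasDerivAt_tailMajorant α r (hx0.trans_le ht.1)).continuousAt.continuousWithinAt)
    (fun t ht => hasDerivAt_tailMajorant α r (hx0.trans ht.1))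
  have hc0 : 0 < c := hx0.trans hc.1
  have h1 : tailMajorant α r x - tailMajorant α r (x + 1) =
      (α * r - (1 - r) * c ^ (-r)) * exp (-α * c ^ r) := by
    have : x + 1 - x = 1 := by ring
    rw [this, div_one] at hc'
    linarith
  rw [h1]
  have h2 : c ^ (-r) ≤ m ^ (-r) :=
    rpow_le_rpow_of_nonpos hm (hx.trans hc.1.le) (by linarith)
  have h3 : (1 - r) * c ^ (-r) ≤ m ^ (-r) := by
    have : 0 ≤ c ^ (-r) := rpow_nonneg hc0.le _
    nlinarith
  have h4 : α * r * (1 - 1 / (α * r * m ^ r)) = α * r - m ^ (-r) := by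
    rw [rpow_neg hm.le]
    have : 0 < m ^ r := rpow_pos_of_pos hm r
    field_simp
  have h5 : exp (-α * (x + 1) ^ r) ≤ exp (-α * c ^ r) := by
    apply exp_le_exp.mpr
    have : c ^ r ≤ (x + 1) ^ r := rpow_le_rpow hc0.le hc.2.le hr0.le
    nlinarith
  have h6 : 0 ≤ α * r * (1 - 1 / (α * r * m ^ r)) := by
    have : 0 ≤ 1 - 1 / (α * r * m ^ r) := by linarith
    positivity
  rw [mul_comm (exp _)]
  exact mul_le_mul (by rw [h4]; linarith) h5 (exp_pos _).le (by rw [h4] at h6; linarith)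

theorem sum_exp_le {α r m : ℝ} (hr0 : 0 < r) (hr1 : r < 1) (hα : 0 < α)
    (hm : 0 < m) (hδ : 1 / (α * r * m ^ r) < 1) (N : ℕ) :
    ∑ j ∈ Finset.range N, exp (-α * (m + (j : ℝ)) ^ r) ≤ exp (-α * m ^ r) +
      exp (-α * m ^ r) * (m ^ (1 - r) / (α * r) / (1 - 1 / (α * r * m ^ r))) := by
  have h6 : 0 < α * r * (1 - 1 / (α * r * m ^ r)) := by
    have : 0 < 1 - 1 / (α * r * m ^ r) := by linarith
    positivity
  have key : ∀ N : ℕ, ∑ j ∈ Finset.range N, exp (-α * (m + ((j : ℝ) + 1)) ^ r) ≤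
      (tailMajorant α r m - tailMajorant α r (m + N)) / (α * r * (1 - 1 / (α * r * m ^ r))) := by
    intro N
    induction N with
    | zero => simp
    | succ k ih =>
      rw [Finset.sum_range_succ]
      have h := exp_le_tailMajorant_sub (x := m + k) hr0 hr1 hα hm (by simp) hδ
      rw [← le_div_iff₀ h6] at h
      push_cast
      rw [← add_assoc m (k : ℝ) 1]
      calc _ ≤ _ + _ := add_le_add ih h
        _ = _ := by rw [← add_div]; congr 1; ring
  cases N with
  | zero =>
    rw [Finset.sum_range_zero]
    have : 0 < 1 - 1 / (α * r * m ^ r) := by linarith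
    positivity
  | succ N =>
    rw [Finset.sum_range_succ']
    have h1 := key N
    have h2 : 0 ≤ tailMajorant α r (m + N) := by unfold tailMajorant; positivity
    have h3 : (tailMajorant α r m - tailMajorant α r (m + N)) / (α * r * (1 - 1 / (α * r * m ^ r)))
        ≤ tailMajorant α r m / (α * r * (1 - 1 / (α * r * m ^ r))) := by
      gcongr; linarith
    have h4 : tailMajorant α r m / (α * r * (1 - 1 / (α * r * m ^ r))) =
        exp (-α * m ^ r) * (m ^ (1 - r) / (α * r) / (1 - 1 / (α * r * m ^ r))) := by
      unfold tailMajorant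
      rw [div_div]; ring
    push_cast
    rw [h4] at h3
    simp only [add_zero]
    linarith

theorem summable_exp_shift {α r m : ℝ} (hr0 : 0 < r) (hr1 : r < 1) (hα : 0 < α)
    (hm : 0 < m) (hδ : 1 / (α * r * m ^ r) < 1) :
    Summable fun j : ℕ => exp (-α * (m + (j : ℝ)) ^ r) :=
  summable_of_sum_range_le (fun _ => (exp_pos _).le) (sum_exp_le hr0 hr1 hα hm hδ)

theorem tsum_exp_le {α r m : ℝ} (hr0 : 0 < r) (hr1 : r < 1) (hα : 0 < α)
    (hm : 0 < m) (hδ : 1 / (α * r * m ^ r) < 1) :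
    ∑' j : ℕ, exp (-α * (m + (j : ℝ)) ^ r) ≤ exp (-α * m ^ r) +
      exp (-α * m ^ r) * (m ^ (1 - r) / (α * r) / (1 - 1 / (α * r * m ^ r))) :=
  (summable_exp_shift hr0 hr1 hα hm hδ).tsum_le_of_sum_range_le (sum_exp_le hr0 hr1 hα hm hδ)

theorem summable_exp_rpow {α r : ℝ} (hr0 : 0 < r) (hr1 : r < 1) (hα : 0 < α) :
    Summable fun k : ℕ => exp (-α * ((k : ℝ) + 1) ^ r) := by
  have h : Filter.Tendsto (fun n : ℕ => 1 / (α * r * (n : ℝ) ^ r)) Filter.atTop (nhds 0) := by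
    have h1 : Filter.Tendsto (fun n : ℕ => (n : ℝ) ^ r) Filter.atTop Filter.atTop :=
      (tendsto_rpow_atTop hr0).comp tendsto_natCast_atTop_atTop
    exact (h1.const_mul_atTop (mul_pos hα hr0)).const_div_atTop 1
  -- The comparison needs `α r m^r > 1`; this holds for large `m`, and summability ignores the first
  -- terms.
  obtain ⟨m, hm, hm1⟩ := ((h.eventually_lt_const one_pos).and (Filter.eventually_ge_atTop 1)).exists
  have hs := summable_exp_shift hr0 hr1 hα (m := m) (by exact_mod_cast hm1) hm
  obtain ⟨l, rfl⟩ : ∃ l, m = l + 1 := ⟨m - 1, by omega⟩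
  rw [← summable_nat_add_iff l]
  refine hs.congr fun j => ?_
  push_cast
  congr 3
  ring

/-! ### Sequences dominating a geometric progression -/

section GeometricComparison

variable {a : ℕ → ℝ} {ρ : ℝ}

theorem pow_le_of_mul_le_succ (hρ0 : 0 < ρ) (h0 : a 0 = 1) (ha : ∀ j, ρ * a j ≤ a (j + 1)) (j : ℕ) :
    ρ ^ j ≤ a j := by
  induction j with
  | zero => simp [h0]
  | succ k ih =>
    rw [pow_succ']
    exact (mul_le_mul_of_nonneg_left ih hρ0.le).trans (ha k)

theorem summable_sub_pow (hρ0 : 0 < ρ) (hρ1 : ρ < 1) (hs : Summable a) :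
    Summable fun j => a j - ρ ^ j :=
  hs.sub (summable_geometric_of_lt_one hρ0.le hρ1)

theorem tsum_sub_pow (hρ0 : 0 < ρ) (hρ1 : ρ < 1) (hs : Summable a) :
    ∑' j, (a j - ρ ^ j) = ∑' j, a j - 1 / (1 - ρ) := by
  rw [hs.tsum_sub (summable_geometric_of_lt_one hρ0.le hρ1), tsum_geometric_of_lt_one hρ0.le hρ1,
    one_div]

theorem hasSum_sub_geometric (hρ0 : 0 < ρ) (hρ1 : ρ < 1) (hs : Summable a) {z : ℂ} (hz : ‖z‖ = 1) :
    HasSum (fun j => ((a j - ρ ^ j : ℝ) : ℂ) * z ^ j) (∑' j, (a j : ℂ) * z ^ j - 1 / (1 - ρ * z)) := by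
  have h1 : Summable fun j => (a j : ℂ) * z ^ j := by
    apply Summable.of_norm
    simpa [hz] using hs.abs
  have h2 : HasSum (fun j => (ρ * z) ^ j) (1 - ρ * z)⁻¹ := by
    apply hasSum_geometric_of_norm_lt_one
    simpa [hz, abs_of_pos hρ0] using hρ1
  have := h1.hasSum.sub h2
  rw [one_div]
  refine this.congr_fun fun j => ?_
  push_cast
  ring

/-- All differences `a j - ρ ^ j` are nonnegative, so their series on the unit circle is largest at
`z = 1`. -/
theorem norm_tsum_sub_le (hρ0 : 0 < ρ) (hρ1 : ρ < 1) (h0 : a 0 = 1)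
    (ha : ∀ j, ρ * a j ≤ a (j + 1)) (hs : Summable a) {z : ℂ} (hz : ‖z‖ = 1) :
    ‖∑' j, (a j : ℂ) * z ^ j - 1 / (1 - ρ * z)‖ ≤ ∑' j, a j - 1 / (1 - ρ) := by
  rw [← tsum_sub_pow hρ0 hρ1 hs]
  refine (hasSum_sub_geometric hρ0 hρ1 hs hz).norm_le_of_bounded
    (summable_sub_pow hρ0 hρ1 hs).hasSum fun j => ?_
  rw [norm_mul, norm_pow, hz, one_pow, mul_one, Complex.norm_real, norm_eq_abs,
    abs_of_nonneg (sub_nonneg.mpr (pow_le_of_mul_le_succ hρ0 h0 ha j))]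

/-- Summation by parts. With `d_j = a_j - ρ^j` and `d_0 = 0`, `(1 - z) D = ∑ (d_{j+1} - d_j)
z^{j+1}`, where `d_{j+1} - d_j = (a_{j+1} - ρ a_j) - (1-ρ) d_j` is a difference of nonnegative
numbers. Each of the two series sums to `(1-ρ) ∑ a_j - 1`. This controls `D` away from `z = 1`,
complementing `norm_tsum_sub_le`. -/
theorem norm_one_sub_mul_tsum_sub_le (hρ0 : 0 < ρ) (hρ1 : ρ < 1) (h0 : a 0 = 1)
    (ha : ∀ j, ρ * a j ≤ a (j + 1)) (hs : Summable a) {z : ℂ} (hz : ‖z‖ = 1) :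
    ‖1 - z‖ * ‖∑' j, (a j : ℂ) * z ^ j - 1 / (1 - ρ * z)‖ ≤ 2 * ((1 - ρ) * ∑' j, a j - 1) := by
  set D := ∑' j, (a j : ℂ) * z ^ j - 1 / (1 - ρ * z) with hD
  have h1 := hasSum_sub_geometric hρ0 hρ1 hs hz
  rw [← hD] at h1
  have h2 : HasSum (fun j => ((a (j + 1) - ρ ^ (j + 1) : ℝ) : ℂ) * z ^ (j + 1)) D := by
    rw [hasSum_nat_add_iff' (f := fun j => ((a j - ρ ^ j : ℝ) : ℂ) * z ^ j) 1 |>.symm] at h1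
    simpa [h0] using h1
  have h3 := h2.sub (h1.mul_left z)
  have hs1 : Summable fun j => a (j + 1) := (summable_nat_add_iff 1).mpr hs
  have h4 : HasSum (fun j => (1 - ρ) * a j - (a j - a (j + 1)) + (1 - ρ) * (a j - ρ ^ j))
      (((1 - ρ) * ∑' j, a j - 1) + ((1 - ρ) * ∑' j, a j - 1)) := by
    refine HasSum.add ?_ ?_
    · have hh := (hs.hasSum.mul_left (1 - ρ)).sub (hs.hasSum.sub hs1.hasSum)
      have e : ∑' j, a j - ∑' j, a (j + 1) = 1 := by
        rw [hs.tsum_eq_zero_add, h0]; ring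
      rwa [e] at hh
    · have hh := (summable_sub_pow hρ0 hρ1 hs).hasSum.mul_left (1 - ρ)
      rw [tsum_sub_pow hρ0 hρ1 hs, mul_sub, mul_one_div_cancel (by linarith)] at hh
      exact hh
  have h5 : D - z * D = (1 - z) * D := by ring
  rw [← norm_mul, ← h5, two_mul]
  refine h3.norm_le_of_bounded h4 fun j => ?_
  have e : ((a (j + 1) - ρ ^ (j + 1) : ℝ) : ℂ) * z ^ (j + 1) - z * (((a j - ρ ^ j : ℝ) : ℂ) * z ^ j)
      = (((a (j + 1) - ρ ^ (j + 1)) - (a j - ρ ^ j) : ℝ) : ℂ) * z ^ (j + 1) := by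
    push_cast; ring
  rw [e, norm_mul, norm_pow, hz, one_pow, mul_one, Complex.norm_real, norm_eq_abs]
  have p1 := ha j
  have p2 := mul_nonneg (sub_nonneg.mpr hρ1.le)
    (sub_nonneg.mpr (pow_le_of_mul_le_succ hρ0 h0 ha j))
  rw [abs_le, pow_succ]
  constructor <;> nlinarith

end GeometricComparison

/-! ### From the geometric kernel to a simple pole -/

/-- Comparison of `1/(1-e^{-z})` with its polar part at `0`. -/
theorem norm_one_div_one_sub_exp_sub_le {l t : ℝ} (hl0 : 0 < l) (hl1 : l ≤ 1 / 8) (ht : |t| ≤ π) :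
    ‖1 / (1 - (rexp (-l) : ℂ) * Complex.exp (t * Complex.I)) - 1 / (l - t * Complex.I)‖ ≤ 120 := by
  set z : ℂ := l - t * Complex.I with hz
  have he : (rexp (-l) : ℂ) * Complex.exp (t * Complex.I) = Complex.exp (-z) := by
    rw [Complex.ofReal_exp, ← Complex.exp_add, hz]; congr 1; push_cast; ring
  rw [he]
  have hre : z.re = l := by simp [hz]
  have him : z.im = -t := by simp [hz]
  have hz0 : z ≠ 0 := by
    intro h; rw [h] at hre; simp at hre; linarith
  have hznorm : ‖z‖ ≤ l + |t| := by
    have := Complex.norm_le_abs_re_add_abs_im z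
    rwa [hre, him, abs_neg, abs_of_pos hl0] at this
  -- `3.275 = 3.15 + 1/8`, from `π < 3.15`.
  have hz4 : ‖z‖ ≤ 3.275 := by
    have := pi_lt_d2; linarith
  -- lower bound for the denominator
  have hlow1 : l / 2 ≤ 1 - rexp (-l) := by
    have h2 : rexp (-l) = (rexp l)⁻¹ := exp_neg l
    have h3 : l + 1 ≤ rexp l := add_one_le_exp l
    have h4 : (rexp l)⁻¹ ≤ (l + 1)⁻¹ := inv_anti₀ (by linarith) h3
    have h5 : (l + 1)⁻¹ ≤ 1 - l / 2 := by
      rw [inv_le_iff_one_le_mul₀ (by linarith)]; nlinarith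
    linarith
  have hA : l / 2 ≤ ‖1 - Complex.exp (-z)‖ := by
    have h1 : ‖Complex.exp (-z)‖ = rexp (-l) := by
      rw [Complex.norm_exp]; simp [hre]
    have := norm_sub_norm_le (1 : ℂ) (Complex.exp (-z))
    rw [h1, norm_one] at this
    linarith
  have hB : |t| / 2 ≤ ‖1 - Complex.exp (-z)‖ := by
    have hsq : ‖1 - Complex.exp (-z)‖ ^ 2 = (1 - rexp (-l)) ^ 2 + 4 * rexp (-l) * sin (t / 2) ^ 2 := by
      rw [← he, Complex.sq_norm, Complex.normSq_apply]
      simp only [Complex.sub_re, Complex.sub_im, Complex.one_re, Complex.one_im, Complex.re_ofReal_mul,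
        Complex.im_ofReal_mul, Complex.exp_ofReal_mul_I_re, Complex.exp_ofReal_mul_I_im]
      have c1 : cos t = 1 - 2 * sin (t / 2) ^ 2 := by
        have := cos_sq' (t / 2)
        have h2 := cos_two_mul (t / 2)
        rw [mul_div_cancel₀ t two_ne_zero] at h2
        rw [h2, this]; ring
      have c2 := sin_sq_add_cos_sq t
      linear_combination (rexp (-l)) ^ 2 * c2 - 2 * rexp (-l) * c1
    have hs : |t| / π ≤ |sin (t / 2)| := by
      have := mul_abs_le_abs_sin (x := t / 2) (by rw [abs_div, abs_two]; linarith)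
      rw [abs_div, abs_two] at this
      calc |t| / π = 2 / π * (|t| / 2) := by ring
        _ ≤ _ := this
    have hs2 : t ^ 2 / π ^ 2 ≤ sin (t / 2) ^ 2 := by
      rw [← sq_abs t, ← sq_abs (sin _), ← div_pow]
      exact pow_le_pow_left₀ (by positivity) hs 2
    have hel : 7 / 8 ≤ rexp (-l) := by linarith [add_one_le_exp (-l)]
    have hpi : π ^ 2 ≤ 10 := by have := pi_lt_d2; nlinarith [pi_pos]
    have hs3 : t ^ 2 / 10 ≤ sin (t / 2) ^ 2 := by
      refine le_trans ?_ hs2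
      gcongr
    refine le_of_sq_le_sq ?_ (norm_nonneg _)
    rw [hsq, div_pow, sq_abs]
    nlinarith [sq_nonneg (1 - rexp (-l)), sq_nonneg t, sq_nonneg (sin (t/2))]
  have hC : ‖z‖ / 4 ≤ ‖1 - Complex.exp (-z)‖ := by linarith
  have hne : 1 - Complex.exp (-z) ≠ 0 := by
    rw [← norm_pos_iff]; exact lt_of_lt_of_le (by positivity) hC
  have hT := Complex.norm_exp_sub_sum_le_norm_mul_exp (-z) 2
  have e1 : 1 / (1 - Complex.exp (-z)) - 1 / z =
      (Complex.exp (-z) - ∑ m ∈ Finset.range 2, (-z) ^ m / (m.factorial : ℂ)) /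
        (z * (1 - Complex.exp (-z))) := by
    rw [Finset.sum_range_succ, Finset.sum_range_one]
    field_simp
    simp
    ring
  rw [e1, norm_div, norm_mul, div_le_iff₀ (by positivity)]
  rw [norm_neg] at hT
  have hexp : rexp ‖z‖ ≤ 30 := by
    have h1 : rexp ‖z‖ ≤ rexp (3 + 0.275) := exp_le_exp.mpr (by linarith)
    have h2 : rexp 3 ≤ 21 := by
      have : rexp 3 = rexp 1 ^ 3 := by rw [← exp_nat_mul]; norm_num
      rw [this]
      calc rexp 1 ^ 3 ≤ 2.7182818286 ^ 3 := pow_le_pow_left₀ (exp_pos _).le exp_one_lt_d9.le 3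
        _ ≤ 21 := by norm_num
    have h3 : rexp 0.275 ≤ 1.4 := by
      have h4 : (1 : ℝ) - 0.275 ≤ rexp (-0.275) := by linarith [add_one_le_exp (-0.275 : ℝ)]
      rw [exp_neg] at h4
      have h5 := mul_le_mul_of_nonneg_right h4 (exp_pos 0.275).le
      rw [inv_mul_cancel₀ (exp_pos _).ne'] at h5
      linarith
    rw [exp_add] at h1
    have := mul_le_mul h2 h3 (exp_pos _).le (by norm_num)
    linarith
  calc _ ≤ ‖z‖ ^ 2 * rexp ‖z‖ := hT
    _ ≤ ‖z‖ ^ 2 * 30 := by gcongr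
    _ = 120 * (‖z‖ * (‖z‖ / 4)) := by ring
    _ ≤ _ := by gcongr

/-! ### The hypergeometric value as an integral -/

/-- The coefficients `(b)_k / k!` of `(1 - y)^{-b}`. -/
def binomCoeff (b : ℝ) (k : ℕ) : ℝ := ((k.factorial : ℝ))⁻¹ * (ascPochhammer ℝ k).eval b

theorem binomCoeff_succ (b : ℝ) (k : ℕ) :
    binomCoeff b (k + 1) = binomCoeff b k * ((b + k) / (k + 1)) := by
  unfold binomCoeff
  rw [ascPochhammer_succ_eval, Nat.factorial_succ]
  push_cast
  field_simp

theorem hasSum_binomCoeff (b : ℝ) {y : ℝ} (hy0 : 0 ≤ y) (hy1 : y < 1) :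
    HasSum (fun k => binomCoeff b k * y ^ k) ((1 - y) ^ (-b)) := by
  have h := (one_div_one_sub_rpow_hasFPowerSeriesOnBall_zero b).hasSum (y := y) (by
    rw [Metric.mem_eball, edist_dist, dist_zero_right, norm_eq_abs, abs_of_nonneg hy0,
      ← ENNReal.ofReal_one]
    exact (ENNReal.ofReal_lt_ofReal_iff one_pos).mpr hy1)
  rw [zero_add, one_div, ← rpow_neg (by linarith)] at h
  refine h.congr_fun fun k => ?_
  rw [FormalMultilinearSeries.ofScalars_apply_eq, smul_eq_mul]
  congr 1
  have e : b + k - 1 - k + 1 = b := by ring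
  have := Ring.factorial_nsmul_multichoose_eq_ascPochhammer b k
  rw [Polynomial.ascPochhammer_smeval_eq_eval] at this
  rw [Ring.choose, e, binomCoeff, ← this, nsmul_eq_mul, inv_mul_cancel_left₀]
  positivity

/-- From the recursion, `(1-b) |c_k| / (k+1) = |c_k| - |c_{k+1}|` as soon as `k ≥ -b`, so the
partial sums telescope. This is the majorant that allows passage to the endpoint `x = 1`. -/
theorem summable_binomCoeff_div {b : ℝ} (hb : b < 1) :
    Summable fun k : ℕ => |binomCoeff b k| / (2 * k + 1) := by
  obtain ⟨k₀, hk₀⟩ := exists_nat_ge (-b)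
  have step : ∀ k : ℕ, |binomCoeff b (k₀ + k)| / (((k₀ + k : ℕ) : ℝ) + 1) * (1 - b) =
      |binomCoeff b (k₀ + k)| - |binomCoeff b (k₀ + k + 1)| := by
    intro k
    rw [binomCoeff_succ, abs_mul, abs_of_nonneg (a := (b + ((k₀ + k : ℕ) : ℝ)) / _)]
    · field_simp; ring
    · have : 0 ≤ b + ((k₀ + k : ℕ) : ℝ) := by push_cast; linarith [(Nat.cast_nonneg k : (0:ℝ) ≤ k)]
      positivity
  have h1 : Summable fun k : ℕ => |binomCoeff b (k₀ + k)| / (((k₀ + k : ℕ) : ℝ) + 1) * (1 - b) := by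
    refine summable_of_sum_range_le (c := |binomCoeff b k₀|)
      (fun k => mul_nonneg (by positivity) (by linarith)) fun N => ?_
    simp_rw [step]
    have := Finset.sum_range_sub' (fun k => |binomCoeff b (k₀ + k)|) N
    simp only [← add_assoc, add_zero] at this
    rw [this]
    linarith [abs_nonneg (binomCoeff b (k₀ + N))]
  have h2 : Summable fun k : ℕ => |binomCoeff b (k₀ + k)| / (((k₀ + k : ℕ) : ℝ) + 1) := by
    refine (h1.mul_right (1 - b)⁻¹).congr fun k => ?_
    rw [mul_assoc, mul_inv_cancel₀ (by linarith), mul_one]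
  have h3 : Summable fun k : ℕ => |binomCoeff b k| / ((k : ℝ) + 1) := by
    rw [← summable_nat_add_iff k₀]
    refine h2.congr fun k => ?_
    rw [add_comm k₀ k]
  refine h3.of_nonneg_of_le (fun k => by positivity) fun k => ?_
  gcongr
  linarith [(Nat.cast_nonneg k : (0:ℝ) ≤ k)]

theorem ascPochhammer_half (k : ℕ) :
    (ascPochhammer ℝ k).eval (3 / 2) = (ascPochhammer ℝ k).eval (1 / 2) * (2 * k + 1) := by
  induction k with
  | zero => simp
  | succ k ih =>
    rw [ascPochhammer_succ_eval, ascPochhammer_succ_eval, ih]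
    push_cast
    ring

/-- The quotient `(1/2)_k / (3/2)_k` collapses to `1/(2k+1)`, so the value is the odd primitive of
`(1-x²)^{-b}` evaluated at `1`. -/
theorem hypergeometric_half_eq_tsum (b : ℝ) :
    ₂F₁ (1 / 2 : ℝ) b (3 / 2) (1 : ℝ) = ∑' k : ℕ, binomCoeff b k / (2 * k + 1) := by
  rw [ordinaryHypergeometric_eq_tsum]
  refine tsum_congr fun k => ?_
  have h : (ascPochhammer ℝ k).eval (1 / 2 : ℝ) ≠ 0 := (ascPochhammer_pos k _ (by norm_num)).ne'
  rw [ascPochhammer_half, one_pow, smul_eq_mul, mul_one, binomCoeff]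
  field_simp

/-- An odd antiderivative of `(1 - x²)^{-b}`, as a power series. -/
def binomPrimitive (b x : ℝ) : ℝ := ∑' k : ℕ, binomCoeff b k / (2 * k + 1) * x ^ (2 * k + 1)

theorem norm_binomPrimitive_term_le (b : ℝ) {x : ℝ} (h0 : 0 ≤ x) (h1 : x ≤ 1) (k : ℕ) :
    ‖binomCoeff b k / (2 * k + 1) * x ^ (2 * k + 1)‖ ≤ |binomCoeff b k| / (2 * k + 1) := by
  rw [norm_mul, norm_div, norm_pow, norm_eq_abs, norm_eq_abs, norm_eq_abs, abs_of_nonneg h0,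
    abs_of_nonneg (by positivity : (0 : ℝ) ≤ 2 * k + 1)]
  exact mul_le_of_le_one_right (by positivity) (pow_le_one₀ h0 h1)

theorem hasDerivAt_binomPrimitive (b : ℝ) {x : ℝ} (h0 : 0 ≤ x) (h1 : x < 1) :
    HasDerivAt (binomPrimitive b) ((1 - x ^ 2) ^ (-b)) x := by
  obtain ⟨R, hxR, hR1⟩ := exists_between h1
  have hR0 : 0 < R := h0.trans_lt hxR
  have hsum : Summable fun k => |binomCoeff b k| * (R ^ 2) ^ k := by
    refine (hasSum_binomCoeff b (y := R ^ 2) (by positivity) (by nlinarith)).summable.abs.congr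
      fun k => ?_
    rw [abs_mul, abs_of_nonneg (a := (R ^ 2) ^ k) (by positivity)]
  have h := hasDerivAt_tsum_of_isPreconnected (t := Set.Ioo (-R) R) (y₀ := 0) (y := x)
    (g := fun (k : ℕ) (x : ℝ) => binomCoeff b k / (2 * k + 1) * x ^ (2 * k + 1))
    (g' := fun (k : ℕ) (x : ℝ) => binomCoeff b k * (x ^ 2) ^ k)
    hsum isOpen_Ioo isPreconnected_Ioo
    (fun k y hy => by
      have := (hasDerivAt_pow (2 * k + 1) y).const_mul (binomCoeff b k / (2 * k + 1))
      refine this.congr_deriv ?_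
      push_cast
      rw [← pow_mul]
      field_simp)
    (fun k y hy => by
      rw [norm_mul, norm_pow, norm_eq_abs, norm_eq_abs, abs_of_nonneg (sq_nonneg y)]
      have : y ^ 2 ≤ R ^ 2 := sq_le_sq' hy.1.le hy.2.le
      gcongr)
    ⟨by linarith, hR0⟩ (by simp) ⟨by linarith, hxR⟩
  rw [(hasSum_binomCoeff b (y := x ^ 2) (by positivity) (by nlinarith)).tsum_eq] at h
  exact h

theorem tendsto_binomPrimitive {b : ℝ} (hb : b < 1) {g : ℝ → ℝ}
    (h0 : ∀ᶠ u in Filter.atTop, 0 ≤ g u ∧ g u ≤ 1) (hg : Filter.Tendsto g Filter.atTop (nhds 1)) :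
    Filter.Tendsto (fun u => binomPrimitive b (g u)) Filter.atTop
      (nhds (₂F₁ (1 / 2 : ℝ) b (3 / 2) (1 : ℝ))) := by
  rw [hypergeometric_half_eq_tsum]
  refine tendsto_tsum_of_dominated_convergence (summable_binomCoeff_div hb) (fun k => ?_)
    (h0.mono fun u hu k => norm_binomPrimitive_term_le b hu.1 hu.2 k)
  have := (hg.pow (2 * k + 1)).const_mul (binomCoeff b k / (2 * k + 1))
  simpa using this

theorem integrable_one_add_sq_rpow {q : ℝ} (hq : 1 < q) :
    Integrable fun u : ℝ => (1 + u ^ 2) ^ (-q / 2) := by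
  have := integrable_rpow_neg_one_add_norm_sq (E := ℝ) (μ := volume) (r := q) (by simpa using hq)
  simpa using this

/-- The substitution `x = u / √(1+u²)` maps `(0,∞)` onto `(0,1)` with `1 - x² = (1+u²)⁻¹` and `dx =
(1+u²)^{-3/2} du`. The integral becomes that of `(1-x²)^{-b}` with `b - 3/2 = -q/2`. -/
theorem integral_Ioi_one_add_sq_rpow {q : ℝ} (hq : 1 < q) :
    ∫ u in Set.Ioi (0 : ℝ), (1 + u ^ 2) ^ (-q / 2) =
      ₂F₁ (1 / 2 : ℝ) ((3 - q) / 2) (3 / 2) (1 : ℝ) := by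
  set b := (3 - q) / 2 with hbdef
  have hb : b < 1 := by rw [hbdef]; linarith
  set g : ℝ → ℝ := fun u => u / √(1 + u ^ 2) with hg
  have hpos : ∀ u : ℝ, 0 < 1 + u ^ 2 := fun u => by positivity
  have hsq : ∀ u : ℝ, √(1 + u ^ 2) ^ 2 = 1 + u ^ 2 := fun u => sq_sqrt (hpos u).le
  have hspos : ∀ u : ℝ, 0 < √(1 + u ^ 2) := fun u => sqrt_pos.mpr (hpos u)
  have hgsq : ∀ u, 1 - g u ^ 2 = (1 + u ^ 2)⁻¹ := by
    intro u
    rw [hg]; simp only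
    rw [div_pow, hsq]
    have := (hpos u).ne'
    field_simp
    ring
  have hg0 : ∀ u, 0 ≤ u → 0 ≤ g u := fun u hu => div_nonneg hu (hspos u).le
  have hg1 : ∀ u, 0 ≤ u → g u < 1 := by
    intro u hu
    have h1 := hgsq u
    have h2 : 0 < (1 + u ^ 2)⁻¹ := inv_pos.mpr (hpos u)
    have := hg0 u hu
    nlinarith
  have hgd : ∀ u, HasDerivAt g ((1 + u ^ 2) ^ (-3 / 2 : ℝ)) u := by
    intro u
    have h1 : HasDerivAt (fun u : ℝ => 1 + u ^ 2) (2 * u) u := by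
      simpa using (hasDerivAt_pow 2 u).const_add 1
    have h2 := (hasDerivAt_id u).div (h1.sqrt (hpos u).ne') (hspos u).ne'
    refine h2.congr_deriv ?_
    have e : (1 + u ^ 2) ^ (-3 / 2 : ℝ) = (√(1 + u ^ 2) ^ 3)⁻¹ := by
      rw [sqrt_eq_rpow, ← rpow_natCast (_ ^ (1 / 2 : ℝ)), ← rpow_mul (hpos u).le,
        ← rpow_neg (hpos u).le]
      norm_num
    rw [e, hsq]
    have := (hspos u).ne'
    have := (hpos u).ne'
    simp only [id]
    field_simp
    rw [hsq]
    ring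
  have hgt : Filter.Tendsto g Filter.atTop (nhds 1) := by
    have h1 : Filter.Tendsto (fun u : ℝ => 1 - (1 + u ^ 2)⁻¹) Filter.atTop (nhds (1 - 0)) := by
      refine tendsto_const_nhds.sub (tendsto_inv_atTop_zero.comp ?_)
      exact Filter.tendsto_atTop_add_const_left _ _ (Filter.tendsto_pow_atTop two_ne_zero)
    have h2 := h1.sqrt
    rw [sub_zero, sqrt_one] at h2
    refine h2.congr' ?_
    filter_upwards [Filter.eventually_ge_atTop 0] with u hu
    rw [← hgsq u, sub_sub_cancel, sqrt_sq (hg0 u hu)]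
  have key := integral_Ioi_of_hasDerivAt_of_tendsto (f := fun u => binomPrimitive b (g u))
    (f' := fun u => (1 + u ^ 2) ^ (-q / 2)) (a := 0)
    (m := ₂F₁ (1 / 2 : ℝ) b (3 / 2) (1 : ℝ))
  have hd : ∀ u ∈ Set.Ici (0 : ℝ),
      HasDerivAt (fun u => binomPrimitive b (g u)) ((1 + u ^ 2) ^ (-q / 2)) u := by
    intro u hu
    have := (hasDerivAt_binomPrimitive b (hg0 u hu) (hg1 u hu)).comp u (hgd u)
    refine this.congr_deriv ?_
    rw [hgsq, inv_rpow (hpos u).le, ← rpow_neg (hpos u).le, ← rpow_add (hpos u)]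
    congr 1
    rw [hbdef]; ring
  rw [key (hd 0 (by simp)).continuousAt.continuousWithinAt (fun u hu => hd u (Set.mem_Ici_of_Ioi hu))
    (integrable_one_add_sq_rpow hq).integrableOn
    (tendsto_binomPrimitive hb ?_ hgt)]
  · have : binomPrimitive b (g 0) = 0 := by simp [binomPrimitive, hg]
    rw [this, sub_zero]
  · filter_upwards [Filter.eventually_ge_atTop 0] with u hu
    exact ⟨hg0 u hu, (hg1 u hu).le⟩

theorem hypergeometric_pos {q : ℝ} (hq : 1 < q) :
    0 < ₂F₁ (1 / 2 : ℝ) ((3 - q) / 2) (3 / 2) (1 : ℝ) := by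
  rw [← integral_Ioi_one_add_sq_rpow hq]
  refine (setIntegral_pos_iff_support_of_nonneg_ae ?_
    (integrable_one_add_sq_rpow hq).integrableOn).mpr ?_
  · exact Filter.Eventually.of_forall fun u => rpow_nonneg (by positivity) _
  · have : Function.support (fun u : ℝ => (1 + u ^ 2) ^ (-q / 2)) = Set.univ := by
      ext u
      simp only [Function.mem_support, Set.mem_univ, iff_true]
      exact (rpow_pos_of_pos (by positivity) _).ne'
    rw [this]; simp

/-- Split at `u = 1`: the integrand is at most `1` before and at most `u^{-q}` after. For conjugate
exponents the bound `q/(q-1)` equals `p`. -/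
theorem hypergeometric_le {q : ℝ} (hq : 1 < q) :
    ₂F₁ (1 / 2 : ℝ) ((3 - q) / 2) (3 / 2) (1 : ℝ) ≤ q / (q - 1) := by
  rw [← integral_Ioi_one_add_sq_rpow hq]
  have hi := integrable_one_add_sq_rpow hq
  rw [← Set.Ioc_union_Ioi_eq_Ioi zero_le_one,
    setIntegral_union Set.Ioc_disjoint_Ioi_same measurableSet_Ioi hi.integrableOn hi.integrableOn]
  have h1 : ∫ u in Set.Ioc (0 : ℝ) 1, (1 + u ^ 2) ^ (-q / 2) ≤ 1 := by
    have : ∫ u in Set.Ioc (0 : ℝ) 1, (1 + u ^ 2) ^ (-q / 2) ≤ ∫ u in Set.Ioc (0 : ℝ) 1, (1 : ℝ) := by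
      refine setIntegral_mono_on hi.integrableOn (by simp) measurableSet_Ioc fun u _ => ?_
      exact rpow_le_one_of_one_le_of_nonpos (by nlinarith [sq_nonneg u]) (by linarith)
    simpa using this
  have h2 : ∫ u in Set.Ioi (1 : ℝ), (1 + u ^ 2) ^ (-q / 2) ≤ 1 / (q - 1) := by
    have : ∫ u in Set.Ioi (1 : ℝ), (1 + u ^ 2) ^ (-q / 2) ≤ ∫ u in Set.Ioi (1 : ℝ), u ^ (-q) := by
      refine setIntegral_mono_on hi.integrableOn
        (integrableOn_Ioi_rpow_of_lt (by linarith) one_pos) measurableSet_Ioi fun u hu => ?_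
      have hu0 : (0 : ℝ) < u := one_pos.trans hu
      have e : u ^ (-q) = (u ^ 2) ^ (-q / 2) := by
        rw [← rpow_natCast, ← rpow_mul hu0.le]; congr 1; push_cast; ring
      rw [e]
      exact rpow_le_rpow_of_nonpos (by positivity) (by linarith) (by linarith)
    rw [integral_Ioi_rpow_of_lt (by linarith) one_pos, one_rpow] at this
    refine this.trans (le_of_eq ?_)
    rw [div_eq_div_iff (by linarith) (by linarith)]; ring
  have h3 : q / (q - 1) = 1 + 1 / (q - 1) := by
    have : q - 1 ≠ 0 := by linarith
    field_simp; ring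
  linarith

/-! ### `L_q` norms of the pole and of its modulations -/

/-- The simple pole `1/(l - it)`. -/
def pole (l t : ℝ) : ℂ := 1 / (l - t * Complex.I)

theorem norm_pole_rpow {l q : ℝ} (hl : 0 < l) (t : ℝ) :
    ‖pole l t‖ ^ q = l ^ (-q) * (1 + (l⁻¹ * t) ^ 2) ^ (-q / 2) := by
  have h1 : ‖(l : ℂ) - t * Complex.I‖ = √(l ^ 2 * (1 + (l⁻¹ * t) ^ 2)) := by
    rw [Complex.norm_def, Complex.normSq_apply]
    congr 1
    simp
    field_simp
  rw [pole, norm_div, norm_one, h1, sqrt_mul (by positivity), sqrt_sq hl.le, one_div,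
    inv_rpow (by positivity), mul_rpow hl.le (by positivity), mul_inv, rpow_neg hl.le]
  congr 1
  rw [sqrt_eq_rpow, ← rpow_mul (by positivity), ← rpow_neg (by positivity)]
  congr 1; ring

theorem integrable_norm_pole_rpow {l q : ℝ} (hl : 0 < l) (hq : 1 < q) :
    Integrable fun t => ‖pole l t‖ ^ q := by
  simp_rw [norm_pole_rpow hl]
  exact ((integrable_one_add_sq_rpow hq).comp_mul_left' (inv_ne_zero hl.ne')).const_mul _

theorem integral_norm_pole_rpow {l q : ℝ} (hl : 0 < l) (hq : 1 < q) :
    ∫ t, ‖pole l t‖ ^ q = l ^ (1 - q) * (2 * ₂F₁ (1 / 2 : ℝ) ((3 - q) / 2) (3 / 2) (1 : ℝ)) := by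
  simp_rw [norm_pole_rpow hl]
  rw [integral_const_mul, Measure.integral_comp_mul_left (fun u : ℝ => (1 + u ^ 2) ^ (-q / 2)),
    inv_inv, abs_of_pos hl, smul_eq_mul, ← integral_Ioi_one_add_sq_rpow hq]
  have h := integral_comp_abs (f := fun u : ℝ => (1 + u ^ 2) ^ (-q / 2))
  simp only [sq_abs] at h
  rw [h, ← mul_assoc, ← rpow_add_one hl.ne', neg_add_eq_sub]

theorem eLpNorm_ofReal_eq {α F : Type*} {m : MeasurableSpace α} {μ : Measure α}
    [NormedAddCommGroup F] {q : ℝ} (hq : 0 < q) (f : α → F) :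
    eLpNorm f (ENNReal.ofReal q) μ = (∫⁻ x, ENNReal.ofReal (‖f x‖ ^ q) ∂μ) ^ (1 / q) := by
  rw [eLpNorm_eq_lintegral_rpow_enorm_toReal (by simpa using hq) ENNReal.ofReal_ne_top,
    ENNReal.toReal_ofReal hq.le]
  congr 2
  ext x
  rw [← ofReal_norm, ENNReal.ofReal_rpow_of_nonneg (norm_nonneg _) hq.le]

theorem eLpNorm_ofReal_eq_integral {α F : Type*} {m : MeasurableSpace α} {μ : Measure α}
    [NormedAddCommGroup F] {q : ℝ} (hq : 0 < q) {f : α → F}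
    (hf : Integrable (fun x => ‖f x‖ ^ q) μ) :
    eLpNorm f (ENNReal.ofReal q) μ = ENNReal.ofReal ((∫ x, ‖f x‖ ^ q ∂μ) ^ (1 / q)) := by
  have h0 : ∀ x, 0 ≤ ‖f x‖ ^ q := fun x => by positivity
  rw [eLpNorm_ofReal_eq hq, ← ofReal_integral_eq_lintegral_ofReal hf (.of_forall h0),
    ENNReal.ofReal_rpow_of_nonneg (integral_nonneg h0) (by positivity)]

theorem continuous_pole {l : ℝ} (hl : 0 < l) : Continuous (pole l) := by
  unfold pole
  refine continuous_const.div (by fun_prop) fun t h => ?_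
  have := congrArg Complex.re h
  simp at this
  exact hl.ne' this

theorem norm_pole_le {l : ℝ} (hl : 0 < l) (t : ℝ) : ‖pole l t‖ ≤ 1 / l := by
  rw [pole, norm_div, norm_one]
  refine one_div_le_one_div_of_le hl ?_
  have := Complex.abs_re_le_norm ((l : ℂ) - t * Complex.I)
  simpa [abs_of_pos hl] using this

/-- The resolvent identity `pole(t+s) - pole(t) = i s · pole(t+s) · pole(t)`, together with `‖pole‖
≤ 1/l`. -/
theorem norm_pole_add_sub_le {l s : ℝ} (hl : 0 < l) (hs : 0 ≤ s) (t : ℝ) :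
    ‖pole l (t + s) - pole l t‖ ≤ s / l * ‖pole l t‖ := by
  have hne : ∀ t : ℝ, (l : ℂ) - t * Complex.I ≠ 0 := by
    intro t h
    have := congrArg Complex.re h
    simp at this
    exact hl.ne' this
  have e : pole l (t + s) - pole l t = s * Complex.I * pole l (t + s) * pole l t := by
    have h1 := hne t
    have h2 := hne (t + s)
    rw [Complex.ofReal_add] at h2
    rw [pole, pole, Complex.ofReal_add, div_sub_div _ _ h2 h1, mul_one_div, mul_one_div, div_div]
    congr 1
    ring
  rw [e, norm_mul, norm_mul, norm_mul, Complex.norm_I, Complex.norm_real, norm_eq_abs,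
    abs_of_nonneg hs, mul_one]
  have := norm_pole_le hl (t + s)
  calc _ ≤ s * (1 / l) * ‖pole l t‖ := by gcongr
    _ = _ := by ring

/-- Rotating `ζ` through all phases makes its real part `‖ζ‖ cos(h + arg ζ)`, and periodicity
removes `arg ζ`. -/
theorem integral_abs_re_mul_exp_rpow (q : ℝ) (ζ : ℂ) :
    ∫ h in (0 : ℝ)..2 * π, |(ζ * Complex.exp (h * Complex.I)).re| ^ q =
      ‖ζ‖ ^ q * ∫ h in (0 : ℝ)..2 * π, |cos h| ^ q := by
  have h1 : ∀ h : ℝ, |(ζ * Complex.exp (h * Complex.I)).re| ^ q =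
      ‖ζ‖ ^ q * |cos (h + ζ.arg)| ^ q := by
    intro h
    have : (ζ * Complex.exp (h * Complex.I)).re = ‖ζ‖ * cos (h + ζ.arg) := by
      conv_lhs => rw [← Complex.norm_mul_exp_arg_mul_I ζ]
      rw [mul_assoc, ← Complex.exp_add, ← add_mul, add_comm, ← Complex.ofReal_add,
        Complex.re_ofReal_mul, Complex.exp_ofReal_mul_I_re]
    rw [this, abs_mul, abs_norm, mul_rpow (norm_nonneg _) (abs_nonneg _)]
  simp_rw [h1]
  rw [intervalIntegral.integral_const_mul,
    intervalIntegral.integral_comp_add_right (fun h => |cos h| ^ q)]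
  congr 1
  have hp : Function.Periodic (fun h => |cos h| ^ q) (2 * π) := fun x => by simp
  have := hp.intervalIntegral_add_eq ζ.arg 0
  rw [zero_add] at this ⊢
  rw [add_comm (2 * π), this]

/-- Among the modulations of `g` there is one whose real part has `L_q` norm at most the average. -/
theorem exists_eLpNorm_re_le {q : ℝ} (hq : 0 < q) {g : ℝ → ℂ} (hg : Continuous g)
    (hgi : Integrable fun t => ‖g t‖ ^ q) :
    ∃ h ∈ Set.Ioc 0 (2 * π),
      eLpNorm (fun t => (g t * Complex.exp (h * Complex.I)).re) (ENNReal.ofReal q) volume ≤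
        ENNReal.ofReal (lpNormPer q cos / (2 * π) ^ (1 / q) * (∫ t, ‖g t‖ ^ q) ^ (1 / q)) := by
  set G : ℝ → ℝ → ENNReal := fun h t =>
    ENNReal.ofReal (|(g t * Complex.exp (h * Complex.I)).re| ^ q) with hG
  have hGc : Continuous (Function.uncurry G) := by
    refine ENNReal.continuous_ofReal.comp ?_
    refine Continuous.rpow_const ?_ fun _ => Or.inr hq.le
    refine (Complex.continuous_re.comp ?_).abs
    exact (hg.comp continuous_snd).mul (by fun_prop)
  have hM0 : 0 ≤ ∫ h in (0 : ℝ)..2 * π, |cos h| ^ q :=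
    intervalIntegral.integral_nonneg two_pi_pos.le fun u _ => by positivity
  have hinner : ∀ t, ∫⁻ h in Set.Ioc 0 (2 * π), G h t =
      ENNReal.ofReal (‖g t‖ ^ q * ∫ h in (0 : ℝ)..2 * π, |cos h| ^ q) := by
    intro t
    have hc : Continuous fun h : ℝ => |(g t * Complex.exp (h * Complex.I)).re| ^ q := by
      refine Continuous.rpow_const ?_ fun _ => Or.inr hq.le
      exact (Complex.continuous_re.comp (by fun_prop)).abs
    rw [← integral_abs_re_mul_exp_rpow, intervalIntegral.integral_of_le two_pi_pos.le,
      ofReal_integral_eq_lintegral_ofReal]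
    · exact (hc.intervalIntegrable 0 (2 * π)).1
    · exact .of_forall fun h => by positivity
  -- Some phase does no worse than the average over phases, which Tonelli's theorem evaluates
  -- through `hinner`.
  obtain ⟨h, hh, hle⟩ := exists_le_setLAverage (μ := volume) (s := Set.Ioc 0 (2 * π))
    (f := fun h => ∫⁻ t, G h t) (by simp [pi_pos]) measure_Ioc_lt_top.ne
    (hGc.measurable.lintegral_prod_right').aemeasurable
  refine ⟨h, hh, ?_⟩
  rw [setLAverage_eq, lintegral_lintegral_swap hGc.measurable.aemeasurable] at hle
  simp_rw [hinner] at hle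
  rw [← ofReal_integral_eq_lintegral_ofReal (hgi.mul_const _)
    (.of_forall fun t => by positivity), integral_mul_const, Real.volume_Ioc, sub_zero,
    ← ENNReal.ofReal_div_of_pos two_pi_pos] at hle
  rw [eLpNorm_ofReal_eq hq]
  have h0 : 0 ≤ ∫ t, ‖g t‖ ^ q := integral_nonneg fun t => by positivity
  calc _ ≤ (ENNReal.ofReal (((∫ t, ‖g t‖ ^ q) * ∫ h in (0 : ℝ)..2 * π, |cos h| ^ q) / (2 * π)))
        ^ (1 / q) := ENNReal.rpow_le_rpow hle (by positivity)
    _ = _ := by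
      rw [ENNReal.ofReal_rpow_of_nonneg (by positivity) (by positivity),
        div_rpow (by positivity) two_pi_pos.le, mul_rpow h0 hM0, lpNormPer]
      congr 1
      ring

/-- The `L_q(ℝ)` norm of the pole `1/(l - it)`. -/
def poleNorm (l q : ℝ) : ℝ := (∫ t, ‖pole l t‖ ^ q) ^ (1 / q)

theorem poleNorm_nonneg (l q : ℝ) : 0 ≤ poleNorm l q :=
  rpow_nonneg (integral_nonneg fun t => by positivity) _

theorem eLpNorm_pole {l q : ℝ} (hl : 0 < l) (hq : 1 < q) :
    eLpNorm (pole l) (ENNReal.ofReal q) volume = ENNReal.ofReal (poleNorm l q) :=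
  eLpNorm_ofReal_eq_integral (by linarith) (integrable_norm_pole_rpow hl hq)

theorem norm_exp_mul_I (x : ℝ) : ‖Complex.exp (x * Complex.I)‖ = 1 :=
  Complex.norm_exp_ofReal_mul_I x

/-- The good phase `h` from `exists_eLpNorm_re_le` need not be the given one. On the whole line,
translation by `s = h/n` preserves the norm, multiplies `e^{int}` by exactly `e^{ih}`, and moves the
pole by a relative error `s/l ≤ 2π/(n l)`. -/
theorem eLpNorm_re_mul_pole_le {l q n : ℝ} (hl : 0 < l) (hq : 1 < q) (hn : 0 < n) {c : ℂ}
    (hc : ‖c‖ = 1) :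
    eLpNorm (fun t : ℝ => (c * Complex.exp ((n * t : ℝ) * Complex.I) * pole l t).re)
        (ENNReal.ofReal q) volume ≤
      ENNReal.ofReal ((lpNormPer q cos / (2 * π) ^ (1 / q) + 2 * π / (n * l)) * poleNorm l q) := by
  have hq0 : 0 < q := by linarith
  set g : ℝ → ℂ := fun t => c * Complex.exp ((n * t : ℝ) * Complex.I) * pole l t with hg
  have hgc : Continuous g := (by fun_prop : Continuous fun t : ℝ =>
    c * Complex.exp ((n * t : ℝ) * Complex.I)).mul (continuous_pole hl)
  have hgn : ∀ t, ‖g t‖ = ‖pole l t‖ := fun t => by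
    rw [hg]; simp only
    rw [norm_mul, norm_mul, hc, norm_exp_mul_I, one_mul, one_mul]
  obtain ⟨h, hh, hle⟩ := exists_eLpNorm_re_le hq0 hgc (by
    simp_rw [hgn]; exact integrable_norm_pole_rpow hl hq)
  simp_rw [hgn] at hle
  set s := h / n with hs
  have hs0 : 0 ≤ s := div_nonneg hh.1.le hn.le
  have hns : n * s = h := by rw [hs]; field_simp
  set H : ℝ → ℝ := fun t => (g t).re with hH
  set R : ℝ → ℝ := fun t => (g t * Complex.exp (h * Complex.I)).re with hR
  have hHc : Continuous H := Complex.continuous_re.comp hgc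
  have hRc : Continuous R := Complex.continuous_re.comp (hgc.mul continuous_const)
  have h1 : eLpNorm H (ENNReal.ofReal q) volume =
      eLpNorm (R + fun t => H (t + s) - R t) (ENNReal.ofReal q) volume := by
    rw [← eLpNorm_comp_measurePreserving (f := fun t => t + s) hHc.aestronglyMeasurable
      (measurePreserving_add_right volume s)]
    congr 1
    ext t
    simp
  have hdiff : ∀ t, ‖H (t + s) - R t‖ ≤ ‖((s / l : ℝ) • pole l) t‖ := by
    intro t
    have e : H (t + s) - R t = (c * Complex.exp ((n * t : ℝ) * Complex.I) *
        Complex.exp (h * Complex.I) * (pole l (t + s) - pole l t)).re := by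
      rw [hH, hR, hg, ← Complex.sub_re, ← hns]
      simp only
      congr 1
      have : Complex.exp ((n * (t + s) : ℝ) * Complex.I) =
          Complex.exp ((n * t : ℝ) * Complex.I) * Complex.exp ((n * s : ℝ) * Complex.I) := by
        rw [← Complex.exp_add]; congr 1; push_cast; ring
      rw [this]; ring
    rw [e, norm_eq_abs]
    refine (Complex.abs_re_le_norm _).trans ?_
    rw [norm_mul, norm_mul, norm_mul, hc, norm_exp_mul_I, norm_exp_mul_I, one_mul, one_mul, one_mul,
      Pi.smul_apply, norm_smul, norm_eq_abs, abs_of_nonneg (by positivity)]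
    exact norm_pole_add_sub_le hl hs0 t
  have hsl : s / l ≤ 2 * π / (n * l) := by
    rw [hs, div_div]; gcongr; exact hh.2
  have hN := poleNorm_nonneg l q
  have hL : 0 ≤ lpNormPer q cos := rpow_nonneg
    (intervalIntegral.integral_nonneg two_pi_pos.le fun u _ => by positivity) _
  rw [h1]
  refine (eLpNorm_add_le hRc.aestronglyMeasurable
    ((hHc.comp (continuous_add_const s)).sub hRc).aestronglyMeasurable (by simpa using hq.le)).trans ?_
  rw [add_mul, ENNReal.ofReal_add (by positivity) (by positivity)]
  refine add_le_add hle ?_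
  refine (eLpNorm_mono hdiff).trans ?_
  rw [eLpNorm_const_smul, eLpNorm_pole hl hq, ← ofReal_norm, norm_eq_abs,
    abs_of_nonneg (by positivity), ← ENNReal.ofReal_mul (by positivity)]
  exact ENNReal.ofReal_le_ofReal (by gcongr)

/-- A modulated function which is close to the pole `1/(l - it)` on a period has real part with
`L_q` norm close to the average one. -/
theorem lpNorm_re_le {l q n B C : ℝ} (hl : 0 < l) (hq : 1 < q) (hn : 0 < n) (hB : 0 ≤ B)
    (hC : 0 ≤ C) {c : ℂ} (hc : ‖c‖ = 1) {K : ℝ → ℂ} (hK : Continuous K)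
    (hKB : ∀ t, |t| ≤ π → ‖K t - pole l t‖ ≤ B * ‖pole l t‖ + C) :
    (∫ t in (-π)..π, |(c * Complex.exp ((n * t : ℝ) * Complex.I) * K t).re| ^ q) ^ (1 / q) ≤
      (lpNormPer q cos / (2 * π) ^ (1 / q) + 2 * π / (n * l) + B) * poleNorm l q +
        C * (2 * π) ^ (1 / q) := by
  have hq0 : 0 < q := by linarith
  set μ := volume.restrict (Set.Ioc (-π) π) with hμ
  set e : ℝ → ℂ := fun t => c * Complex.exp ((n * t : ℝ) * Complex.I) with he
  have hec : Continuous e := by fun_prop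
  have hen : ∀ t, ‖e t‖ = 1 := fun t => by
    rw [he]; simp only
    rw [norm_mul, hc, norm_exp_mul_I, one_mul]
  set H : ℝ → ℝ := fun t => (e t * pole l t).re with hH
  set E : ℝ → ℝ := fun t => (e t * (K t - pole l t)).re with hE
  have hHc : Continuous H := Complex.continuous_re.comp (hec.mul (continuous_pole hl))
  have hEc : Continuous E := Complex.continuous_re.comp (hec.mul (hK.sub (continuous_pole hl)))
  have hQ : (fun t => (e t * K t).re) = H + E := by
    ext t
    rw [Pi.add_apply, hH, hE, ← Complex.add_re]
    congr 1; ring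
  have hQc : Continuous fun t => (e t * K t).re := Complex.continuous_re.comp (hec.mul hK)
  have hL : 0 ≤ lpNormPer q cos := rpow_nonneg
    (intervalIntegral.integral_nonneg two_pi_pos.le fun u _ => by positivity) _
  have hN := poleNorm_nonneg l q
  have hEb : ∀ᵐ t ∂μ, ‖E t‖ ≤ (fun t => B * ‖pole l t‖ + C) t := by
    rw [hμ]
    refine (ae_restrict_iff' measurableSet_Ioc).mpr (.of_forall fun t ht => ?_)
    rw [norm_eq_abs]
    refine (Complex.abs_re_le_norm _).trans ?_
    rw [norm_mul, hen, one_mul]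
    exact hKB t (abs_le.mpr ⟨ht.1.le, ht.2⟩)
  have hE2 : eLpNorm E (ENNReal.ofReal q) μ ≤
      ENNReal.ofReal (B * poleNorm l q + C * (2 * π) ^ (1 / q)) := by
    refine (eLpNorm_mono_ae_real hEb).trans ?_
    have e1 : (fun t => B * ‖pole l t‖ + C) = (B • fun t => ‖pole l t‖) + fun _ => C := by
      ext t; simp
    rw [e1]
    refine (eLpNorm_add_le ((continuous_pole hl).norm.const_smul B).aestronglyMeasurable
      aestronglyMeasurable_const (by simpa using hq.le)).trans ?_
    rw [ENNReal.ofReal_add (by positivity) (by positivity)]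
    refine add_le_add ?_ ?_
    · rw [eLpNorm_const_smul, eLpNorm_norm, ENNReal.ofReal_mul hB, ← ofReal_norm,
        norm_eq_abs, abs_of_nonneg hB, ← eLpNorm_pole hl hq]
      gcongr
      exact Measure.restrict_le_self
    · rw [eLpNorm_const _ (by simpa using hq0) (by
        rw [hμ, Ne, Measure.restrict_eq_zero]; simp [pi_pos])]
      rw [hμ, Measure.restrict_apply_univ, Real.volume_Ioc, ENNReal.toReal_ofReal hq0.le,
        ← ofReal_norm, norm_eq_abs, abs_of_nonneg hC,
        ENNReal.ofReal_rpow_of_nonneg (by linarith [pi_pos]) (by positivity),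
        ← ENNReal.ofReal_mul hC]
      apply le_of_eq
      congr 3
      ring
  have hH2 : eLpNorm H (ENNReal.ofReal q) μ ≤
      ENNReal.ofReal ((lpNormPer q cos / (2 * π) ^ (1 / q) + 2 * π / (n * l)) * poleNorm l q) :=
    (eLpNorm_mono_measure _ Measure.restrict_le_self).trans (eLpNorm_re_mul_pole_le hl hq hn hc)
  have hfin : eLpNorm (fun t => (e t * K t).re) (ENNReal.ofReal q) μ ≤
      ENNReal.ofReal ((lpNormPer q cos / (2 * π) ^ (1 / q) + 2 * π / (n * l) + B) * poleNorm l q +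
        C * (2 * π) ^ (1 / q)) := by
    rw [hQ]
    refine (eLpNorm_add_le hHc.aestronglyMeasurable hEc.aestronglyMeasurable
      (by simpa using hq.le)).trans ((add_le_add hH2 hE2).trans ?_)
    rw [← ENNReal.ofReal_add (by positivity) (by positivity)]
    exact ENNReal.ofReal_le_ofReal (by linarith)
  have hint : Integrable (fun t => ‖(e t * K t).re‖ ^ q) μ :=
    ((hQc.norm.rpow_const fun _ => Or.inr hq0.le).intervalIntegrable (-π) π).1
  rw [eLpNorm_ofReal_eq_integral hq0 hint, ENNReal.ofReal_le_ofReal_iff (by positivity)] at hfin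
  rw [intervalIntegral.integral_of_le (by linarith [pi_pos])]
  exact hfin

/-! ### The tail of the generalized Poisson kernel -/

theorem integral_period_eq {g : ℝ → ℝ} (hg : Function.Periodic g (2 * π)) :
    ∫ t in (0 : ℝ)..2 * π, g t = ∫ t in (-π)..π, g t := by
  have := hg.intervalIntegral_add_eq 0 (-π)
  rw [zero_add] at this
  rw [this]
  congr 1
  ring

/-- The tail `∑_{k ≥ n} e^{-α k^r} cos (k t - β π / 2)` of the generalized Poisson kernel. -/
def kernelTail (α r β : ℝ) (n : ℕ) (t : ℝ) : ℝ :=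
  ∑' j : ℕ, exp (-α * ((n : ℝ) + j) ^ r) * cos (((n : ℝ) + j) * t - β * π / 2)

theorem periodic_kernelTail (α r β : ℝ) (n : ℕ) :
    Function.Periodic (kernelTail α r β n) (2 * π) := by
  intro t
  refine tsum_congr fun j => ?_
  have := cos_add_nat_mul_two_pi (((n : ℝ) + j) * t - β * π / 2) (n + j)
  rw [← this]
  push_cast
  congr 2
  ring

theorem norm_kernelTail_term_le (α r β : ℝ) (n j : ℕ) (t : ℝ) :
    ‖exp (-α * ((n : ℝ) + j) ^ r) * cos (((n : ℝ) + j) * t - β * π / 2)‖ ≤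
      exp (-α * ((n : ℝ) + j) ^ r) := by
  rw [norm_mul, norm_eq_abs, norm_eq_abs, abs_exp]
  exact mul_le_of_le_one_right (exp_pos _).le (abs_cos_le_one _)

theorem summable_exp_add {α r : ℝ} (hr0 : 0 < r) (hr1 : r < 1) (hα : 0 < α) {n : ℕ} (hn : 1 ≤ n) :
    Summable fun j : ℕ => exp (-α * ((n : ℝ) + j) ^ r) := by
  obtain ⟨m, rfl⟩ : ∃ m, n = m + 1 := ⟨n - 1, by omega⟩
  refine ((summable_nat_add_iff m).mpr (summable_exp_rpow hr0 hr1 hα)).congr fun j => ?_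
  push_cast
  congr 3
  ring

theorem continuous_kernelTail {α r : ℝ} (β : ℝ) (hr0 : 0 < r) (hr1 : r < 1) (hα : 0 < α) {n : ℕ}
    (hn : 1 ≤ n) : Continuous (kernelTail α r β n) :=
  continuous_tsum (fun j => by fun_prop) (summable_exp_add hr0 hr1 hα hn)
    fun j t => norm_kernelTail_term_le α r β n j t

/-- Normalized coefficients of the tail of the kernel. -/
def tailCoeff (α r : ℝ) (n j : ℕ) : ℝ := exp (-α * (((n : ℝ) + j) ^ r - (n : ℝ) ^ r))

theorem exp_mul_tailCoeff (α r : ℝ) (n j : ℕ) :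
    exp (-α * (n : ℝ) ^ r) * tailCoeff α r n j = exp (-α * ((n : ℝ) + j) ^ r) := by
  rw [tailCoeff, ← exp_add]; congr 1; ring

theorem summable_tailCoeff {α r : ℝ} (hr0 : 0 < r) (hr1 : r < 1) (hα : 0 < α) {n : ℕ}
    (hn : 1 ≤ n) : Summable (tailCoeff α r n) := by
  have h := summable_exp_add hr0 hr1 hα hn
  simp_rw [← exp_mul_tailCoeff] at h
  exact (summable_mul_left_iff (exp_pos _).ne').mp h

theorem tailCoeff_zero (α r : ℝ) (n : ℕ) : tailCoeff α r n 0 = 1 := by simp [tailCoeff]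

/-- Concavity of `x^r`: its unit increments beyond `n` are at most `r n^{r-1}`. This is the
hypothesis of the geometric comparison with `ρ = e^{-l}`. -/
theorem mul_tailCoeff_le {α r : ℝ} (hr0 : 0 < r) (hr1 : r < 1) (hα : 0 < α) {n : ℕ}
    (hn : 1 ≤ n) (j : ℕ) :
    exp (-(α * r * (n : ℝ) ^ (r - 1))) * tailCoeff α r n j ≤ tailCoeff α r n (j + 1) := by
  have hn0 : (0 : ℝ) < n := by exact_mod_cast hn
  have h := rpow_succ_sub_le_of_le (x := (n : ℝ) + j) hr0 hr1 hn0 (by simp)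
  unfold tailCoeff
  rw [← exp_add]
  apply exp_le_exp.mpr
  push_cast
  rw [← add_assoc]
  have := mul_le_mul_of_nonneg_left h hα.le
  linarith

theorem tsum_tailCoeff_le {α r : ℝ} (hr0 : 0 < r) (hr1 : r < 1) (hα : 0 < α) {n : ℕ}
    (hn : 1 ≤ n) (hδ : 1 / (α * r * (n : ℝ) ^ r) ≤ 1 / 2) :
    ∑' j, tailCoeff α r n j ≤
      1 + 1 / (α * r * (n : ℝ) ^ (r - 1)) * (1 + 2 * (1 / (α * r * (n : ℝ) ^ r))) := by
  have hn0 : (0 : ℝ) < n := by exact_mod_cast hn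
  have h := tsum_exp_le hr0 hr1 hα hn0 (by linarith)
  simp_rw [← exp_mul_tailCoeff] at h
  rw [tsum_mul_left] at h
  have h2 : ∑' j, tailCoeff α r n j ≤
      1 + (n : ℝ) ^ (1 - r) / (α * r) / (1 - 1 / (α * r * (n : ℝ) ^ r)) :=
    le_of_mul_le_mul_left (by linarith) (exp_pos (-α * (n : ℝ) ^ r))
  refine h2.trans ?_
  have e : (n : ℝ) ^ (1 - r) / (α * r) = 1 / (α * r * (n : ℝ) ^ (r - 1)) := by
    rw [show (1 : ℝ) - r = -(r - 1) by ring, rpow_neg hn0.le]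
    field_simp
  rw [e]
  set δ := 1 / (α * r * (n : ℝ) ^ r)
  have hδ0 : 0 < δ := by positivity
  have : 1 / (1 - δ) ≤ 1 + 2 * δ := by
    rw [div_le_iff₀ (by linarith)]; nlinarith
  rw [div_eq_mul_one_div (1 / (α * r * (n : ℝ) ^ (r - 1)))]
  gcongr

/-- The analytic sum `∑ a_j e^{i j t}` of the normalized tail coefficients. -/
def tailSum (α r : ℝ) (n : ℕ) (t : ℝ) : ℂ :=
  ∑' j : ℕ, (tailCoeff α r n j : ℂ) * Complex.exp (t * Complex.I) ^ j

theorem summable_tailSum {α r : ℝ} (hr0 : 0 < r) (hr1 : r < 1) (hα : 0 < α) {n : ℕ}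
    (hn : 1 ≤ n) (t : ℝ) :
    Summable fun j : ℕ => (tailCoeff α r n j : ℂ) * Complex.exp (t * Complex.I) ^ j := by
  apply Summable.of_norm
  simpa [norm_exp_mul_I] using (summable_tailCoeff hr0 hr1 hα hn).abs

theorem continuous_tailSum {α r : ℝ} (hr0 : 0 < r) (hr1 : r < 1) (hα : 0 < α) {n : ℕ}
    (hn : 1 ≤ n) : Continuous (tailSum α r n) := by
  refine continuous_tsum (fun j => by fun_prop) (summable_tailCoeff hr0 hr1 hα hn).abs
    fun j t => ?_
  rw [norm_mul, norm_pow, norm_exp_mul_I, one_pow, mul_one, Complex.norm_real, norm_eq_abs]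

theorem kernelTail_eq {α r : ℝ} (β : ℝ) (hr0 : 0 < r) (hr1 : r < 1) (hα : 0 < α) {n : ℕ}
    (hn : 1 ≤ n) (t : ℝ) :
    kernelTail α r β n t = exp (-α * (n : ℝ) ^ r) *
      (Complex.exp ((-(β * π / 2) : ℝ) * Complex.I) * Complex.exp ((n * t : ℝ) * Complex.I) *
        tailSum α r n t).re := by
  rw [tailSum, ← tsum_mul_left, Complex.re_tsum ((summable_tailSum hr0 hr1 hα hn t).mul_left _),
    ← tsum_mul_left, kernelTail]
  refine tsum_congr fun j => ?_
  have e : Complex.exp ((-(β * π / 2) : ℝ) * Complex.I) * Complex.exp ((n * t : ℝ) * Complex.I) *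
      ((tailCoeff α r n j : ℂ) * Complex.exp (t * Complex.I) ^ j) =
      (tailCoeff α r n j : ℂ) * Complex.exp ((((n : ℝ) + j) * t - β * π / 2 : ℝ) * Complex.I) := by
    rw [← Complex.exp_nat_mul, ← Complex.exp_add, mul_left_comm, ← Complex.exp_add]
    congr 2
    push_cast
    ring
  rw [e, Complex.re_ofReal_mul, Complex.exp_ofReal_mul_I_re, ← exp_mul_tailCoeff]
  ring

/-- The two geometric estimates bound both `l ‖D‖` and `|t| ‖D‖` by multiples of `l + 2δ`. Adding
them and using `1/(l+|t|) ≤ ‖pole l t‖` gives an error relative to the pole; the replacement of the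
geometric kernel by the pole costs the additive `120`. -/
theorem norm_tailSum_sub_pole_le {α r : ℝ} (hr0 : 0 < r) (hr1 : r < 1) (hα : 0 < α) {n : ℕ}
    (hn : 1 ≤ n) {l δ : ℝ} (hl : l = α * r * (n : ℝ) ^ (r - 1)) (hδ : δ = 1 / (α * r * (n : ℝ) ^ r))
    (hl1 : l ≤ 1 / 8) (hδ1 : δ ≤ 1 / 2) {t : ℝ} (ht : |t| ≤ π) :
    ‖tailSum α r n t - pole l t‖ ≤ (1 + π) * (l + 2 * δ) * ‖pole l t‖ + 120 := by
  have hn0 : (0 : ℝ) < n := by exact_mod_cast hn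
  have hl0 : 0 < l := by rw [hl]; positivity
  have hδ0 : 0 < δ := by rw [hδ]; positivity
  have hpi := pi_pos
  set ρ := exp (-l) with hρ
  have hρ0 : 0 < ρ := exp_pos _
  have hρ1 : ρ < 1 := by rw [hρ, exp_lt_one_iff]; linarith
  have hμ : 1 - ρ ≤ l := by linarith [add_one_le_exp (-l)]
  set S := ∑' j, tailCoeff α r n j with hS
  have hSle : S ≤ 1 + 1 / l * (1 + 2 * δ) := by
    rw [hl, hδ]; exact tsum_tailCoeff_le hr0 hr1 hα hn (by rw [← hδ]; exact hδ1)
  have hz := norm_exp_mul_I t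
  have hmul : ∀ j, ρ * tailCoeff α r n j ≤ tailCoeff α r n (j + 1) := by
    rw [hρ, hl]; exact mul_tailCoeff_le hr0 hr1 hα hn
  have hs := summable_tailCoeff hr0 hr1 hα hn
  have h1 := norm_tsum_sub_le hρ0 hρ1 (tailCoeff_zero α r n) hmul hs hz
  have h2 := norm_one_sub_mul_tsum_sub_le hρ0 hρ1 (tailCoeff_zero α r n) hmul hs hz
  rw [← tailSum, ← hS] at h1 h2
  set D := tailSum α r n t - 1 / (1 - ρ * Complex.exp (t * Complex.I)) with hD
  have hD1 : l * ‖D‖ ≤ l + 2 * δ := by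
    have : 1 / l ≤ 1 / (1 - ρ) := one_div_le_one_div_of_le (by linarith) hμ
    have h3 : ‖D‖ ≤ 1 + 1 / l * (2 * δ) := by linarith
    calc l * ‖D‖ ≤ l * (1 + 1 / l * (2 * δ)) := by gcongr
      _ = _ := by field_simp
  have hS0 : 0 ≤ S := tsum_nonneg fun j => (exp_pos _).le
  have hD2 : |t| * ‖D‖ ≤ π * (l + 2 * δ) := by
    have h3 : (1 - ρ) * S ≤ l + 1 + 2 * δ := by
      calc (1 - ρ) * S ≤ l * (1 + 1 / l * (1 + 2 * δ)) := by gcongr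
        _ = _ := by field_simp; ring
    -- `‖1 - e^{it}‖ = 2 |sin(t/2)|`, and Jordan's inequality applies for `|t| ≤ π`.
    have h4 : 2 * |t| / π ≤ ‖1 - Complex.exp (t * Complex.I)‖ := by
      have := mul_abs_le_abs_sin (x := t / 2) (by rw [abs_div, abs_two]; linarith)
      rw [norm_sub_rev, mul_comm (t : ℂ), Complex.norm_exp_I_mul_ofReal_sub_one, norm_mul, norm_eq_abs,
        norm_eq_abs, abs_two]
      rw [abs_div, abs_two] at this
      calc 2 * |t| / π = 2 * (2 / π * (|t| / 2)) := by ring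
        _ ≤ _ := by gcongr
    have h5 : 2 * |t| / π * ‖D‖ ≤ 2 * (l + 2 * δ) := by
      refine (mul_le_mul_of_nonneg_right h4 (norm_nonneg _)).trans ?_
      linarith
    calc |t| * ‖D‖ = (π / 2) * (2 * |t| / π * ‖D‖) := by field_simp
      _ ≤ (π / 2) * (2 * (l + 2 * δ)) := by gcongr
      _ = _ := by ring
  have hpole : 1 / (l + |t|) ≤ ‖pole l t‖ := by
    rw [pole, norm_div, norm_one]
    refine one_div_le_one_div_of_le ?_ ?_
    · rw [norm_pos_iff]
      intro h
      have := congrArg Complex.re h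
      simp at this
      exact hl0.ne' this
    · have := Complex.norm_le_abs_re_add_abs_im ((l : ℂ) - t * Complex.I)
      simpa [abs_of_pos hl0] using this
  have hDp : ‖D‖ ≤ (1 + π) * (l + 2 * δ) * ‖pole l t‖ := by
    have hlt : 0 < l + |t| := by positivity
    have : ‖D‖ ≤ (1 + π) * (l + 2 * δ) * (1 / (l + |t|)) := by
      rw [mul_one_div, le_div_iff₀ hlt]; linarith
    refine this.trans ?_
    gcongr
  have hG := norm_one_div_one_sub_exp_sub_le hl0 hl1 ht
  rw [← hρ, ← pole] at hG
  have e : tailSum α r n t - pole l t =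
      D + (1 / (1 - ρ * Complex.exp (t * Complex.I)) - pole l t) := by rw [hD]; ring
  rw [e]
  exact (norm_add_le _ _).trans (add_le_add hDp hG)

theorem lpNormPer_kernelTail_le {α r : ℝ} (β : ℝ) (hr0 : 0 < r) (hr1 : r < 1) (hα : 0 < α) {n : ℕ}
    (hn : 1 ≤ n) {l δ q : ℝ} (hl : l = α * r * (n : ℝ) ^ (r - 1))
    (hδ : δ = 1 / (α * r * (n : ℝ) ^ r)) (hl1 : l ≤ 1 / 8) (hδ1 : δ ≤ 1 / 2) (hq : 1 < q) :
    lpNormPer q (kernelTail α r β n) ≤ exp (-α * (n : ℝ) ^ r) *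
      ((lpNormPer q cos / (2 * π) ^ (1 / q) + 2 * π * δ + (1 + π) * (l + 2 * δ)) * poleNorm l q +
        120 * (2 * π) ^ (1 / q)) := by
  have hn0 : (0 : ℝ) < n := by exact_mod_cast hn
  have hl0 : 0 < l := by rw [hl]; positivity
  have hδ0 : 0 < δ := by rw [hδ]; positivity
  have hpi := pi_pos
  have hnl : δ = 1 / (n * l) := by
    rw [hδ, hl, rpow_sub_one hn0.ne']
    field_simp
  have h := lpNorm_re_le (q := q) (n := n) (B := (1 + π) * (l + 2 * δ)) (C := 120) hl0 hq hn0
    (by positivity) (by norm_num) (c := Complex.exp ((-(β * π / 2) : ℝ) * Complex.I))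
    (norm_exp_mul_I _) (continuous_tailSum hr0 hr1 hα hn)
    (fun t ht => norm_tailSum_sub_pole_le hr0 hr1 hα hn hl hδ hl1 hδ1 ht)
  rw [div_eq_mul_one_div (2 * π) (n * l), ← hnl] at h
  have hper : Function.Periodic (fun t => |kernelTail α r β n t| ^ q) (2 * π) := fun t => by
    simp only [periodic_kernelTail α r β n t]
  rw [lpNormPer, integral_period_eq hper]
  simp_rw [kernelTail_eq β hr0 hr1 hα hn, abs_mul, abs_exp,
    mul_rpow (exp_pos _).le (abs_nonneg _)]
  rw [intervalIntegral.integral_const_mul, mul_rpow (by positivity)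
    (intervalIntegral.integral_nonneg (by linarith) fun u _ => by positivity),
    ← rpow_mul (exp_pos _).le, mul_one_div_cancel (by linarith), rpow_one]
  exact mul_le_mul_of_nonneg_left h (exp_pos _).le

theorem abs_kernelTail_le {α r : ℝ} (β : ℝ) (hr0 : 0 < r) (hr1 : r < 1) (hα : 0 < α) {n : ℕ}
    (hn : 1 ≤ n) (t : ℝ) :
    |kernelTail α r β n t| ≤ exp (-α * (n : ℝ) ^ r) * ∑' j, tailCoeff α r n j := by
  rw [← tsum_mul_left]
  simp_rw [exp_mul_tailCoeff]
  exact tsum_of_norm_bounded (summable_exp_add hr0 hr1 hα hn).hasSum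
    fun j => norm_kernelTail_term_le α r β n j t

/-! ### Fourier sums of the class and orthogonality -/

theorem integral_cos_int_mul_add {m : ℤ} (hm : m ≠ 0) (c : ℝ) :
    ∫ x in (-π)..π, cos (m * x + c) = 0 := by
  have hm' : (m : ℝ) ≠ 0 := by exact_mod_cast hm
  rw [intervalIntegral.integral_comp_mul_add (fun x => cos x) hm', integral_cos]
  have := sin_add_int_mul_two_pi (m * (-π) + c) m
  rw [show m * (-π) + c + m * (2 * π) = m * π + c by ring] at this
  rw [this]; simp

theorem integral_cos_mul_cos (k j : ℕ) (hk : 1 ≤ k) (c d : ℝ) :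
    ∫ x in (-π)..π, cos (k * x + c) * cos (j * x + d) = if k = j then π * cos (c - d) else 0 := by
  have h1 : ∀ x : ℝ, cos (k * x + c) * cos (j * x + d) =
      (1 / 2) * (cos (((k + j : ℤ) : ℝ) * x + (c + d)) + cos (((k - j : ℤ) : ℝ) * x + (c - d))) := by
    intro x
    have e1 : ((k + j : ℤ) : ℝ) * x + (c + d) = (k * x + c) + (j * x + d) := by push_cast; ring
    have e2 : ((k - j : ℤ) : ℝ) * x + (c - d) = (k * x + c) - (j * x + d) := by push_cast; ring
    rw [e1, e2, cos_add (k * x + c), cos_sub (k * x + c)]; ring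
  simp_rw [h1]
  rw [intervalIntegral.integral_const_mul, intervalIntegral.integral_add
    (Continuous.intervalIntegrable (by fun_prop) _ _)
    (Continuous.intervalIntegrable (by fun_prop) _ _), integral_cos_int_mul_add (by omega), zero_add]
  split_ifs with h
  · subst h
    simp
    ring
  · rw [integral_cos_int_mul_add (by omega), mul_zero]

/-- The general term of a trigonometric series. -/
def trigTerm (A B : ℕ → ℝ) (k : ℕ) (x : ℝ) : ℝ :=
  A k * cos (((k : ℝ) + 1) * x) + B k * sin (((k : ℝ) + 1) * x)

theorem norm_trigTerm_le (A B : ℕ → ℝ) (k : ℕ) (x : ℝ) : ‖trigTerm A B k x‖ ≤ |A k| + |B k| := by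
  rw [trigTerm]
  refine (norm_add_le _ _).trans (add_le_add ?_ ?_)
  · rw [norm_mul]; exact mul_le_of_le_one_right (abs_nonneg _) (abs_cos_le_one _)
  · rw [norm_mul]; exact mul_le_of_le_one_right (abs_nonneg _) (abs_sin_le_one _)

theorem continuous_trigTerm (A B : ℕ → ℝ) (k : ℕ) : Continuous (trigTerm A B k) := by
  unfold trigTerm; fun_prop

theorem integral_trigTerm_mul_cos (A B : ℕ → ℝ) (k j : ℕ) (d : ℝ) :
    ∫ x in (-π)..π, trigTerm A B k x * cos (j * x + d) =
      if k + 1 = j then π * (A k * cos d - B k * sin d) else 0 := by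
  have h1 : ∀ x : ℝ, trigTerm A B k x * cos (j * x + d) =
      A k * (cos (((k + 1 : ℕ) : ℝ) * x + 0) * cos (j * x + d)) +
        B k * (cos (((k + 1 : ℕ) : ℝ) * x + (-(π / 2))) * cos (j * x + d)) := by
    intro x
    rw [trigTerm, ← sub_eq_add_neg, cos_sub_pi_div_two]
    push_cast
    rw [add_zero]; ring
  simp_rw [h1]
  rw [intervalIntegral.integral_add (Continuous.intervalIntegrable (by fun_prop) _ _)
    (Continuous.intervalIntegrable (by fun_prop) _ _), intervalIntegral.integral_const_mul,
    intervalIntegral.integral_const_mul, integral_cos_mul_cos _ _ (by omega),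
    integral_cos_mul_cos _ _ (by omega)]
  split_ifs
  · rw [zero_sub, cos_neg, show -(π / 2) - d = -(d + π / 2) by ring, cos_neg, cos_add_pi_div_two]
    ring
  · ring

section TrigSeries

variable {A B : ℕ → ℝ} {a₀ : ℝ} {f : ℝ → ℝ}

/-- Termwise integration under an absolutely summable majorant. The phase `d` treats both kinds of
coefficient at once: `d = 0` gives the cosine ones and `d = -π/2` the sine ones. -/
theorem hasSum_integral_trigSeries (hs : Summable fun k => |A k| + |B k|)
    (hf : ∀ x, f x = a₀ / 2 + ∑' k, trigTerm A B k x) (j : ℕ) (d : ℝ) :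
    HasSum (fun k => if k + 1 = j then π * (A k * cos d - B k * sin d) else 0)
      ((∫ x in (-π)..π, f x * cos (j * x + d)) - a₀ / 2 * ∫ x in (-π)..π, cos (j * x + d)) := by
  have hc : Continuous fun x => ∑' k, trigTerm A B k x :=
    continuous_tsum (continuous_trigTerm A B) hs fun k x => norm_trigTerm_le A B k x
  have h := intervalIntegral.hasSum_integral_of_dominated_convergence (μ := volume) (a := -π) (b := π)
    (F := fun k x => trigTerm A B k x * cos (j * x + d))
    (f := fun x => (∑' k, trigTerm A B k x) * cos (j * x + d))
    (fun k _ => |A k| + |B k|)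
    (fun k => ((continuous_trigTerm A B k).mul (by fun_prop)).aestronglyMeasurable)
    (fun k => .of_forall fun x _ => by
      rw [norm_mul]
      exact (mul_le_of_le_one_right (norm_nonneg _) (abs_cos_le_one _)).trans
        (norm_trigTerm_le A B k x))
    (.of_forall fun x _ => hs) (by simp)
    (.of_forall fun x _ =>
      (hs.of_norm_bounded fun k => norm_trigTerm_le A B k x).hasSum.mul_right _)
  simp_rw [integral_trigTerm_mul_cos] at h
  suffices e : (∫ x in (-π)..π, f x * cos (j * x + d)) - a₀ / 2 * ∫ x in (-π)..π, cos (j * x + d) =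
      ∫ x in (-π)..π, (∑' k, trigTerm A B k x) * cos (j * x + d) by rwa [e]
  rw [← intervalIntegral.integral_const_mul, ← intervalIntegral.integral_sub]
  · congr 1
    ext x
    rw [hf]; ring
  · simp_rw [hf]
    exact ((continuous_const.add hc).mul (by fun_prop)).intervalIntegrable _ _
  · exact Continuous.intervalIntegrable (by fun_prop) _ _

theorem integral_trigSeries_mul_cos_succ (hs : Summable fun k => |A k| + |B k|)
    (hf : ∀ x, f x = a₀ / 2 + ∑' k, trigTerm A B k x) (j : ℕ) (d : ℝ) :
    ∫ x in (-π)..π, f x * cos (((j + 1 : ℕ) : ℝ) * x + d) = π * (A j * cos d - B j * sin d) := by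
  have h := hasSum_integral_trigSeries hs hf (j + 1) d
  have h0 := integral_cos_int_mul_add (m := ((j + 1 : ℕ) : ℤ)) (by omega) d
  rw [Int.cast_natCast] at h0
  rw [h0, mul_zero, sub_zero] at h
  refine h.unique ?_
  have := hasSum_single (f := fun k => if k + 1 = j + 1 then π * (A k * cos d - B k * sin d) else 0)
    j (fun k hk => by simp [hk])
  simpa using this

theorem integral_trigSeries (hs : Summable fun k => |A k| + |B k|)
    (hf : ∀ x, f x = a₀ / 2 + ∑' k, trigTerm A B k x) :
    ∫ x in (-π)..π, f x = π * a₀ := by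
  have h := hasSum_integral_trigSeries hs hf 0 0
  simp only [Nat.add_eq_zero_iff, one_ne_zero, and_false, if_false] at h
  have := h.unique hasSum_zero
  simp at this
  linarith

theorem fourierSum_trigSeries (hs : Summable fun k => |A k| + |B k|)
    (hf : ∀ x, f x = a₀ / 2 + ∑' k, trigTerm A B k x) (m : ℕ) (x : ℝ) :
    fourierSum m f x = a₀ / 2 + ∑ k ∈ Finset.range m, trigTerm A B k x := by
  have h0 : cosCoeff f 0 = a₀ := by
    rw [cosCoeff]
    simp only [Nat.cast_zero, zero_mul, cos_zero, mul_one]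
    rw [integral_trigSeries hs hf]
    field_simp
  have hA : ∀ k, cosCoeff f (k + 1) = A k := by
    intro k
    have := integral_trigSeries_mul_cos_succ hs hf k 0
    simp only [add_zero, cos_zero, sin_zero, mul_one, mul_zero, sub_zero] at this
    rw [cosCoeff, this]
    field_simp
  have hB : ∀ k, sinCoeff f (k + 1) = B k := by
    intro k
    have := integral_trigSeries_mul_cos_succ hs hf k (-(π / 2))
    simp only [← sub_eq_add_neg, cos_sub_pi_div_two, cos_neg, cos_pi_div_two, sin_neg,
      sin_pi_div_two] at this
    rw [sinCoeff, this]
    field_simp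
    ring
  rw [fourierSum, trigPoly, h0]
  congr 1
  -- `trigTerm A B k` carries the harmonic `k + 1`, hence the shift of index.
  rw [Finset.sum_bij' (s := Finset.Icc 1 m) (t := Finset.range m) (i := fun k _ => k - 1)
    (j := fun k _ => k + 1) (g := fun k => trigTerm A B k x)]
  · intro k hk; rw [Finset.mem_Icc] at hk; rw [Finset.mem_range]; omega
  · intro k hk; rw [Finset.mem_range] at hk; rw [Finset.mem_Icc]; omega
  · intro k hk; rw [Finset.mem_Icc] at hk; omega
  · intro k hk; rfl
  · intro k hk
    rw [Finset.mem_Icc] at hk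
    obtain ⟨l, rfl⟩ : ∃ l, k = l + 1 := ⟨k - 1, by omega⟩
    rw [hA, hB, Nat.add_sub_cancel, trigTerm]
    push_cast
    rfl

theorem sub_fourierSum_trigSeries (hs : Summable fun k => |A k| + |B k|)
    (hf : ∀ x, f x = a₀ / 2 + ∑' k, trigTerm A B k x) (m : ℕ) (x : ℝ) :
    f x - fourierSum m f x = ∑' k, trigTerm A B (k + m) x := by
  rw [fourierSum_trigSeries hs hf, hf,
    ← (hs.of_norm_bounded fun k => norm_trigTerm_le A B k x).sum_add_tsum_nat_add m]
  ring

end TrigSeries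

theorem hasSum_integral_kernelTail {α r : ℝ} (β : ℝ) (hr0 : 0 < r) (hr1 : r < 1) (hα : 0 < α)
    {n : ℕ} (hn : 1 ≤ n) {ψ : ℝ → ℝ} (hψ : IntervalIntegrable ψ volume (-π) π) (x : ℝ) :
    HasSum (fun j : ℕ => exp (-α * ((n : ℝ) + j) ^ r) *
        ∫ t in (-π)..π, cos (((n : ℝ) + j) * (x - t) - β * π / 2) * ψ t)
      (∫ t in (-π)..π, kernelTail α r β n (x - t) * ψ t) := by
  have hs := summable_exp_add hr0 hr1 hα hn
  have h := intervalIntegral.hasSum_integral_of_dominated_convergence (μ := volume) (a := -π) (b := π)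
    (F := fun (j : ℕ) t => exp (-α * ((n : ℝ) + j) ^ r) *
      cos (((n : ℝ) + j) * (x - t) - β * π / 2) * ψ t)
    (f := fun t => kernelTail α r β n (x - t) * ψ t)
    (fun j t => exp (-α * ((n : ℝ) + j) ^ r) * |ψ t|)
    (fun j => by
      refine AEStronglyMeasurable.mul (Continuous.aestronglyMeasurable (by fun_prop)) ?_
      exact hψ.def'.aestronglyMeasurable)
    (fun j => .of_forall fun t _ => by
      rw [norm_mul, norm_eq_abs (ψ t)]
      exact mul_le_mul_of_nonneg_right (norm_kernelTail_term_le α r β n j (x - t)) (abs_nonneg _))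
    (.of_forall fun t _ => hs.mul_right _)
    (by simp_rw [tsum_mul_right]; exact hψ.abs.const_mul _)
    (.of_forall fun t _ =>
      (hs.of_norm_bounded fun j => norm_kernelTail_term_le α r β n j (x - t)).hasSum.mul_right _)
  refine h.congr_fun fun j => ?_
  rw [← intervalIntegral.integral_const_mul]
  simp_rw [mul_assoc]

theorem continuous_trigPoly (m : ℕ) (a b : ℕ → ℝ) : Continuous (trigPoly m a b) := by
  unfold trigPoly; fun_prop

theorem periodic_trigPoly (m : ℕ) (a b : ℕ → ℝ) : Function.Periodic (trigPoly m a b) (2 * π) := by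
  intro x
  unfold trigPoly
  congr 1
  refine Finset.sum_congr rfl fun k _ => ?_
  rw [mul_add, cos_add_nat_mul_two_pi, sin_add_nat_mul_two_pi]

theorem integral_cos_mul_trigPoly {k m : ℕ} (hkm : m < k) (a b : ℕ → ℝ) (x c : ℝ) :
    ∫ t in (-π)..π, cos ((k : ℝ) * (x - t) - c) * trigPoly m a b t = 0 := by
  have e : ∀ t : ℝ, cos ((k : ℝ) * (x - t) - c) = cos (k * t + (c - k * x)) := by
    intro t; rw [← cos_neg]; congr 1; ring
  have h1 : ∀ t : ℝ, cos ((k : ℝ) * (x - t) - c) * trigPoly m a b t =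
      a 0 / 2 * (cos (k * t + (c - k * x)) * cos ((0 : ℕ) * t + 0)) +
      ∑ j ∈ Finset.Icc 1 m, (a j * (cos (k * t + (c - k * x)) * cos (j * t + 0)) +
        b j * (cos (k * t + (c - k * x)) * cos (j * t + (-(π / 2))))) := by
    intro t
    rw [e, trigPoly, mul_add, Finset.mul_sum]
    congr 1
    · simp; ring
    · refine Finset.sum_congr rfl fun j _ => ?_
      rw [← sub_eq_add_neg (_ * t), cos_sub_pi_div_two, add_zero]; ring
  simp_rw [h1]
  rw [intervalIntegral.integral_add (Continuous.intervalIntegrable (by fun_prop) _ _)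
    (Continuous.intervalIntegrable (by fun_prop) _ _), intervalIntegral.integral_finsetSum
    (fun j _ => Continuous.intervalIntegrable (by fun_prop) _ _),
    intervalIntegral.integral_const_mul, integral_cos_mul_cos _ _ (by omega),
    if_neg (by omega), mul_zero, zero_add]
  refine Finset.sum_eq_zero fun j hj => ?_
  rw [Finset.mem_Icc] at hj
  rw [intervalIntegral.integral_add (Continuous.intervalIntegrable (by fun_prop) _ _)
    (Continuous.intervalIntegrable (by fun_prop) _ _), intervalIntegral.integral_const_mul,
    intervalIntegral.integral_const_mul, integral_cos_mul_cos _ _ (by omega),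
    integral_cos_mul_cos _ _ (by omega), if_neg (by omega), if_neg (by omega)]
  ring

theorem MemLpPer.intervalIntegrable {p : ℝ} (hp : 1 ≤ p) {φ : ℝ → ℝ} (h : MemLpPer p φ) (a b : ℝ) :
    IntervalIntegrable φ volume a b := by
  refine h.1.intervalIntegrable (t := 0) two_pi_pos.ne' ?_ a b
  rw [zero_add, intervalIntegrable_iff_integrableOn_Ico_of_le two_pi_pos.le]
  exact h.2.integrable (by simpa using hp)

theorem MemLpPer.sub_trigPoly {p : ℝ} {φ : ℝ → ℝ} (h : MemLpPer p φ) (m : ℕ) (a b : ℕ → ℝ) :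
    MemLpPer p fun x => φ x - trigPoly m a b x := by
  refine ⟨h.1.sub (periodic_trigPoly m a b), h.2.sub ?_⟩
  have hc := continuous_trigPoly m a b
  obtain ⟨C, hC⟩ := (isCompact_Icc (a := 0) (b := 2 * π)).exists_bound_of_continuousOn hc.continuousOn
  exact MemLp.of_bound hc.aestronglyMeasurable C
    ((ae_restrict_iff' measurableSet_Ico).mpr (.of_forall fun x hx => hC x ⟨hx.1, hx.2.le⟩))

theorem kernel_eq_kernelTail (α r β : ℝ) : kernel α r β = kernelTail α r β 1 := by
  ext t
  refine tsum_congr fun k => ?_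
  rw [Nat.cast_one, add_comm (1 : ℝ)]

theorem integral_cos_sub_mul_eq {φ : ℝ → ℝ} (hφ : IntervalIntegrable φ volume (-π) π) (k c x : ℝ) :
    ∫ t in (-π)..π, cos (k * (x - t) - c) * φ t =
      (∫ t in (-π)..π, cos (k * t + c) * φ t) * cos (k * x) +
        (∫ t in (-π)..π, sin (k * t + c) * φ t) * sin (k * x) := by
  rw [← intervalIntegral.integral_mul_const, ← intervalIntegral.integral_mul_const,
    ← intervalIntegral.integral_add]
  · congr 1
    ext t
    rw [show k * (x - t) - c = k * x - (k * t + c) by ring, cos_sub]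
    ring
  · exact (hφ.continuousOn_mul (Continuous.continuousOn (by fun_prop))).mul_const _
  · exact (hφ.continuousOn_mul (Continuous.continuousOn (by fun_prop))).mul_const _

theorem abs_integral_mul_le {φ g : ℝ → ℝ} (hφ : IntervalIntegrable φ volume (-π) π) (hg : ∀ t, |g t| ≤ 1)
    : |∫ t in (-π)..π, g t * φ t| ≤ ∫ t in (-π)..π, |φ t| := by
  rw [← norm_eq_abs]
  refine intervalIntegral.norm_integral_le_of_norm_le (by linarith [pi_pos]) (.of_forall fun t _ => ?_)
    hφ.abs
  rw [norm_mul]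
  exact mul_le_of_le_one_left (abs_nonneg _) (hg t)

/-- Convolution with the kernel turns `f` into an absolutely convergent trigonometric series, so
subtracting the Fourier sum leaves its tail. The polynomial in the last claim is arbitrary because
harmonics of order at least `n` annihilate it. -/
theorem continuous_periodic_sub_fourierSum {α r β p : ℝ} (hr0 : 0 < r) (hr1 : r < 1) (hα : 0 < α)
    (hp : 1 ≤ p) {f φ : ℝ → ℝ} (h : IsGenDeriv α r β p f φ) :
    Continuous f ∧ Function.Periodic f (2 * π) ∧ ∀ n : ℕ, 1 ≤ n → ∀ x, ∀ a b : ℕ → ℝ,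
      f x - fourierSum (n - 1) f x =
        1 / π * ∫ t in (-π)..π, kernelTail α r β n (x - t) * (φ t - trigPoly (n - 1) a b t) := by
  obtain ⟨hφ, -, a₀, hf⟩ := h
  have hφi := hφ.intervalIntegrable hp (-π) π
  set c := β * π / 2 with hc
  set A : ℕ → ℝ := fun k => 1 / π * (exp (-α * ((1 : ℝ) + k) ^ r) *
    ∫ t in (-π)..π, cos (((k : ℝ) + 1) * t + c) * φ t) with hA
  set B : ℕ → ℝ := fun k => 1 / π * (exp (-α * ((1 : ℝ) + k) ^ r) *
    ∫ t in (-π)..π, sin (((k : ℝ) + 1) * t + c) * φ t) with hB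
  have hterm : ∀ k x, trigTerm A B k x = 1 / π * (exp (-α * ((1 : ℝ) + k) ^ r) *
      ∫ t in (-π)..π, cos (((k : ℝ) + 1) * (x - t) - c) * φ t) := by
    intro k x
    rw [integral_cos_sub_mul_eq hφi, trigTerm, hA, hB]
    ring
  have hs1 := summable_exp_add hr0 hr1 hα (n := 1) le_rfl
  rw [Nat.cast_one] at hs1
  have hs : Summable fun k => |A k| + |B k| := by
    have hb : ∀ (k : ℕ) (y : ℝ), |y| ≤ ∫ t in (-π)..π, |φ t| →
        |1 / π * (exp (-α * ((1 : ℝ) + k) ^ r) * y)| ≤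
          exp (-α * ((1 : ℝ) + k) ^ r) * (1 / π * ∫ t in (-π)..π, |φ t|) := by
      intro k y hy
      rw [abs_mul, abs_mul, abs_exp, abs_of_pos (one_div_pos.mpr pi_pos), mul_left_comm]
      have := pi_pos
      gcongr
    refine Summable.add ?_ ?_
    · exact (hs1.mul_right _).of_nonneg_of_le (fun k => abs_nonneg _)
        fun k => hb k _ (abs_integral_mul_le hφi fun t => abs_cos_le_one _)
    · exact (hs1.mul_right _).of_nonneg_of_le (fun k => abs_nonneg _)
        fun k => hb k _ (abs_integral_mul_le hφi fun t => abs_sin_le_one _)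
  have hf' : ∀ x, f x = a₀ / 2 + ∑' k, trigTerm A B k x := by
    intro x
    rw [hf, kernel_eq_kernelTail,
      ← (hasSum_integral_kernelTail β hr0 hr1 hα le_rfl hφi x).tsum_eq, ← tsum_mul_left]
    congr 1
    refine tsum_congr fun k => ?_
    rw [hterm, Nat.cast_one, add_comm (1 : ℝ)]
  refine ⟨?_, ?_, ?_⟩
  · have : f = fun x => a₀ / 2 + ∑' k, trigTerm A B k x := funext hf'
    rw [this]
    exact continuous_const.add
      (continuous_tsum (continuous_trigTerm A B) hs fun k x => norm_trigTerm_le A B k x)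
  · intro x
    rw [hf, hf, kernel_eq_kernelTail]
    congr 3
    ext t
    rw [add_sub_right_comm, periodic_kernelTail]
  · intro n hn x a b
    have hψ : IntervalIntegrable (fun t => φ t - trigPoly (n - 1) a b t) volume (-π) π :=
      (hφ.sub_trigPoly (n - 1) a b).intervalIntegrable hp _ _
    rw [sub_fourierSum_trigSeries hs hf',
      ← (hasSum_integral_kernelTail β hr0 hr1 hα hn hψ x).tsum_eq, ← tsum_mul_left]
    refine tsum_congr fun j => ?_
    -- The truncated subtraction is genuine since `1 ≤ n`; the shifted series starts at the harmonic
    -- `n`.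
    have e1 : (((j + (n - 1) : ℕ) : ℝ)) + 1 = n + j := by
      rw [← Nat.cast_add_one, ← Nat.cast_add]; congr 1; omega
    have e2 : (n : ℝ) + j = ((n + j : ℕ) : ℝ) := by push_cast; rfl
    rw [hterm, add_comm (1 : ℝ), e1]
    congr 2
    simp_rw [mul_sub (cos _)]
    rw [intervalIntegral.integral_sub, e2, integral_cos_mul_trigPoly (by omega), sub_zero]
    · exact hφi.continuousOn_mul (Continuous.continuousOn (by fun_prop))
    · exact ((continuous_trigPoly _ a b).intervalIntegrable _ _).continuousOn_mul
        (Continuous.continuousOn (by fun_prop))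

/-! ### From convolution bounds to best approximation -/

theorem lpNormPer_nonneg (p : ℝ) (g : ℝ → ℝ) : 0 ≤ lpNormPer p g :=
  rpow_nonneg (intervalIntegral.integral_nonneg two_pi_pos.le fun u _ => by positivity) _

theorem bestApprox_nonneg (n : ℕ) (p : ℝ) (φ : ℝ → ℝ) : 0 ≤ bestApprox n p φ :=
  Real.sInf_nonneg fun _ ⟨_, _, he⟩ => he ▸ lpNormPer_nonneg _ _

/-- An upper bound for the convolution with the tail of the kernel gives an upper bound for the
deviation of Fourier sums in terms of the best approximation. -/
theorem uniformNorm_sub_fourierSum_le {α r β p W : ℝ} (hr0 : 0 < r) (hr1 : r < 1) (hα : 0 < α)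
    (hp : 1 ≤ p) {n : ℕ} (hn : 1 ≤ n) (hW : 0 ≤ W)
    (hconv : ∀ x, ∀ ψ : ℝ → ℝ, MemLpPer p ψ →
      |∫ t in (-π)..π, kernelTail α r β n (x - t) * ψ t| ≤ W * lpNormPer p ψ)
    {f φ : ℝ → ℝ} (h : IsGenDeriv α r β p f φ) :
    Continuous f ∧ Function.Periodic f (2 * π) ∧
      uniformNorm (fun x => f x - fourierSum (n - 1) f x) ≤ 1 / π * W * bestApprox n p φ := by
  obtain ⟨h1, h2, h3⟩ := continuous_periodic_sub_fourierSum hr0 hr1 hα hp h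
  refine ⟨h1, h2, ciSup_le fun x => ?_⟩
  have hpos : 0 ≤ 1 / π * W := mul_nonneg (one_div_pos.mpr pi_pos).le hW
  -- With the nonnegative factor inside the infimum, it suffices to bound the deviation for each
  -- polynomial separately.
  rw [bestApprox, ← smul_eq_mul, ← Real.sInf_smul_of_nonneg hpos]
  refine le_csInf (Set.Nonempty.smul_set ⟨_, 0, 0, rfl⟩) ?_
  rintro _ ⟨_, ⟨a, b, rfl⟩, rfl⟩
  simp only [smul_eq_mul]
  rw [h3 n hn x a b, abs_mul, abs_of_pos (one_div_pos.mpr pi_pos)]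
  rw [mul_assoc]
  exact mul_le_mul_of_nonneg_left (hconv x _ (h.1.sub_trigPoly _ a b)) (one_div_pos.mpr pi_pos).le

theorem abs_convolution_le {p q : ℝ} (hpq : p.HolderConjugate q) {g ψ : ℝ → ℝ} (hg : Continuous g)
    (hgp : Function.Periodic g (2 * π)) (hψ : MemLpPer p ψ) (x : ℝ) :
    |∫ t in (-π)..π, g (x - t) * ψ t| ≤ lpNormPer q g * lpNormPer p ψ := by
  have hgx : Function.Periodic (fun t => g (x - t)) (2 * π) := fun t => by
    have := hgp (x - (t + 2 * π))
    simp only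
    rw [← this]; congr 1; ring
  have hgc : Continuous fun t => g (x - t) := by fun_prop
  have hprod : Function.Periodic (fun t => g (x - t) * ψ t) (2 * π) := fun t => by
    have := hgx t
    simp only at this ⊢
    rw [this, hψ.1]
  rw [← integral_period_eq hprod]
  have hmψ : MemLp ψ (ENNReal.ofReal p) (volume.restrict (Set.Ioc 0 (2 * π))) := by
    rw [← Measure.restrict_congr_set (Ico_ae_eq_Ioc (a := 0) (b := 2 * π))]
    exact hψ.2
  obtain ⟨C, hC⟩ := (isCompact_Icc (a := 0) (b := 2 * π)).exists_bound_of_continuousOn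
    hgc.continuousOn
  have hmg : MemLp (fun t => g (x - t)) (ENNReal.ofReal q) (volume.restrict (Set.Ioc 0 (2 * π))) :=
    MemLp.of_bound hgc.aestronglyMeasurable C
      ((ae_restrict_iff' measurableSet_Ioc).mpr (.of_forall fun t ht => hC t ⟨ht.1.le, ht.2⟩))
  have hH := integral_mul_norm_le_Lp_mul_Lq hpq.symm hmg hmψ
  have hgn : lpNormPer q g = (∫ t in Set.Ioc 0 (2 * π), ‖g (x - t)‖ ^ q) ^ (1 / q) := by
    rw [lpNormPer, ← intervalIntegral.integral_of_le two_pi_pos.le]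
    have hper : Function.Periodic (fun t => |g t| ^ q) (2 * π) := fun t => by
      simp only [hgp t]
    have h1 := intervalIntegral.integral_comp_sub_left (a := 0) (b := 2 * π) (fun t => |g t| ^ q) x
    have h2 := hper.intervalIntegral_add_eq (x - 2 * π) 0
    simp only [norm_eq_abs]
    rw [h1, sub_zero]
    rw [sub_add_cancel, zero_add] at h2
    rw [h2]
  have hψn : lpNormPer p ψ = (∫ t in Set.Ioc 0 (2 * π), ‖ψ t‖ ^ p) ^ (1 / p) := by
    rw [lpNormPer, ← intervalIntegral.integral_of_le two_pi_pos.le]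
    rfl
  rw [hgn, hψn]
  refine le_trans ?_ hH
  rw [intervalIntegral.integral_of_le two_pi_pos.le, ← norm_eq_abs]
  refine (norm_integral_le_integral_norm _).trans (le_of_eq ?_)
  simp_rw [norm_mul]

theorem abs_convolution_le_of_bound {M : ℝ} {g ψ : ℝ → ℝ} (hM : ∀ t, |g t| ≤ M)
    (hψ : MemLpPer 1 ψ) (x : ℝ) :
    |∫ t in (-π)..π, g (x - t) * ψ t| ≤ M * lpNormPer 1 ψ := by
  have hi := hψ.intervalIntegrable le_rfl (-π) π
  have hper : Function.Periodic (fun t => |ψ t|) (2 * π) := fun t => by simp only [hψ.1 t]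
  have e : lpNormPer 1 ψ = ∫ t in (-π)..π, |ψ t| := by
    rw [← integral_period_eq hper, lpNormPer]
    simp
  rw [e, ← intervalIntegral.integral_const_mul]
  rw [← norm_eq_abs]
  refine intervalIntegral.norm_integral_le_of_norm_le (by linarith [pi_pos])
    (.of_forall fun t _ => ?_) (hi.abs.const_mul M)
  rw [norm_mul]
  exact mul_le_mul_of_nonneg_right (hM _) (abs_nonneg _)

/-! ### The threshold `n₀` and the final constants -/

/-- The left side tends to `0`, so the set defining `n₀` is nonempty and its infimum is attained;
the left side decreases in `n`, so the inequality persists beyond `n₀`. -/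
theorem threshold_of_le {α r p : ℝ} (hr0 : 0 < r) (hr1 : r < 1) (hα : 0 < α) (hp : 1 ≤ p) {n : ℕ}
    (hn : n₀ α r p ≤ n) :
    1 / (α * r) * (1 / (n : ℝ) ^ r) + α * r * p / (n : ℝ) ^ (1 - r) ≤
      if p = 1 then 1 / 14 else 1 / (3 * π) ^ 3 * ((p - 1) / p) := by
  set κ : ℝ := if p = 1 then 1 / 14 else 1 / (3 * π) ^ 3 * ((p - 1) / p) with hκ
  have hκ0 : 0 < κ := by
    rw [hκ]
    split_ifs with h
    · norm_num
    · have : 0 < p - 1 := by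
        rcases lt_or_eq_of_le hp with h1 | h1
        · linarith
        · exact absurd h1.symm h
      have := pi_pos
      positivity
  have ht : Filter.Tendsto
      (fun n : ℕ => 1 / (α * r) * (1 / (n : ℝ) ^ r) + α * r * p / (n : ℝ) ^ (1 - r))
      Filter.atTop (nhds 0) := by
    have h1 : ∀ s : ℝ, 0 < s → Filter.Tendsto (fun n : ℕ => (n : ℝ) ^ s) Filter.atTop Filter.atTop :=
      fun s hs => (tendsto_rpow_atTop hs).comp tendsto_natCast_atTop_atTop
    have h2 := ((h1 r hr0).const_div_atTop 1).const_mul (1 / (α * r))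
    have h3 := (h1 (1 - r) (by linarith)).const_div_atTop (α * r * p)
    simpa using h2.add h3
  have hne : {n : ℕ | 1 ≤ n ∧
      1 / (α * r) * (1 / (n : ℝ) ^ r) + α * r * p / (n : ℝ) ^ (1 - r) ≤ κ}.Nonempty := by
    obtain ⟨m, hm1, hm2⟩ :=
      ((ht.eventually_lt_const hκ0).and (Filter.eventually_ge_atTop 1)).exists
    exact ⟨m, hm2, hm1.le⟩
  obtain ⟨hm1, hm2⟩ := Nat.sInf_mem hne
  change 1 ≤ n₀ α r p at hm1
  change 1 / (α * r) * (1 / (n₀ α r p : ℝ) ^ r) + α * r * p / (n₀ α r p : ℝ) ^ (1 - r) ≤ κ at hm2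
  refine le_trans ?_ hm2
  have hm0 : (0 : ℝ) < n₀ α r p := by exact_mod_cast hm1
  have hmn : (n₀ α r p : ℝ) ≤ n := by exact_mod_cast hn
  gcongr

theorem poleNorm_eq {l p q : ℝ} (hl : 0 < l) (hpq : p.HolderConjugate q) :
    poleNorm l q =
      l ^ (-(1 / p)) * (2 * ₂F₁ (1 / 2 : ℝ) ((3 - q) / 2) (3 / 2) (1 : ℝ)) ^ (1 / q) := by
  have hq := hpq.symm.lt
  have hF := hypergeometric_pos hq
  rw [poleNorm, integral_norm_pole_rpow hl hq, mul_rpow (by positivity) (by positivity),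
    ← rpow_mul hl.le]
  congr 2
  have h := hpq.inv_add_inv_eq_one
  have hq0 : q ≠ 0 := by linarith
  rw [one_div, one_div, sub_mul, mul_inv_cancel₀ hq0]
  linarith

theorem fourteen_pi_sq_ge : 1764 ≤ (14 * π) ^ 2 := by nlinarith [pi_gt_three]

/-- The main term and the error terms for `1 < p < ∞`. -/
theorem one_div_pi_mul_tail_le {α r p q : ℝ} (hr0 : 0 < r) (hα : 0 < α)
    (hpq : p.HolderConjugate q) {n : ℕ} (hn : 1 ≤ n) {l δ : ℝ}
    (hl : l = α * r * (n : ℝ) ^ (r - 1)) (hδ : δ = 1 / (α * r * (n : ℝ) ^ r))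
    (hlp : 2 * p * l ≤ 1) :
    1 / π * ((lpNormPer q cos / (2 * π) ^ (1 / q) + 2 * π * δ + (1 + π) * (l + 2 * δ)) *
        poleNorm l q + 120 * (2 * π) ^ (1 / q)) ≤
      (n : ℝ) ^ ((1 - r) / p) *
        (lpNormPer q cos / (π ^ (1 + 1 / q) * (α * r) ^ (1 / p)) *
            (₂F₁ (1 / 2 : ℝ) ((3 - q) / 2) (3 / 2) (1 : ℝ)) ^ (1 / q) +
          (14 * π) ^ 2 *
            ((1 + (α * r) ^ ((q - 1) / p) / (q - 1)) * (1 / (n : ℝ) ^ ((1 - r) / p)) +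
              p ^ (1 / q) / (α * r) ^ (1 + 1 / p) * (1 / (n : ℝ) ^ r))) := by
  have hn0 : (0 : ℝ) < n := by exact_mod_cast hn
  have hp1 := hpq.lt
  have hq1 := hpq.symm.lt
  have hp0 : 0 < p := by linarith
  have hq0 : 0 < q := by linarith
  have hl0 : 0 < l := by rw [hl]; positivity
  have hδ0 : 0 < δ := by rw [hδ]; positivity
  have hpi := pi_pos
  have hconj := hpq.inv_add_inv_eq_one
  rw [← one_div, ← one_div] at hconj
  have hF0 := hypergeometric_pos hq1
  have hFp : ₂F₁ (1 / 2 : ℝ) ((3 - q) / 2) (3 / 2) (1 : ℝ) ≤ p := by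
    refine (hypergeometric_le hq1).trans (le_of_eq ?_)
    have : q - 1 ≠ 0 := by linarith
    field_simp at hconj ⊢
    linarith
  have hN := poleNorm_eq hl0 hpq
  set F := ₂F₁ (1 / 2 : ℝ) ((3 - q) / 2) (3 / 2) (1 : ℝ) with hF
  set N := poleNorm l q with hNdef
  set L := lpNormPer q cos with hL
  have hN0 : 0 ≤ N := poleNorm_nonneg l q
  have hq1' : 1 / q ≤ 1 := by rw [div_le_one hq0]; linarith
  set P := (n : ℝ) ^ ((1 - r) / p) with hP
  set A := (α * r) ^ (1 / p) with hA
  have hP0 : 0 < P := by positivity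
  have hA0 : 0 < A := by positivity
  have hlP : l ^ (-(1 / p)) = P / A := by
    rw [hl, mul_rpow (by positivity) (by positivity), rpow_neg (by positivity), ← hA,
      ← rpow_mul hn0.le, hP]
    rw [show (r - 1) * -(1 / p) = (1 - r) / p by ring]
    ring
  have hmain : 1 / π * (L / (2 * π) ^ (1 / q) * N) = P * (L / (π ^ (1 + 1 / q) * A) * F ^ (1 / q)) := by
    rw [hN, hlP, mul_rpow (by norm_num) hF0.le, mul_rpow (by norm_num) hpi.le, rpow_add hpi, rpow_one]
    field_simp
  have hNle : N ≤ P / A * (2 * p ^ (1 / q)) := by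
    rw [hN, hlP, mul_rpow (by norm_num) hF0.le]
    have h2 : (2 : ℝ) ^ (1 / q) ≤ 2 := by
      calc (2 : ℝ) ^ (1 / q) ≤ 2 ^ (1 : ℝ) := rpow_le_rpow_of_exponent_le (by norm_num) hq1'
        _ = 2 := rpow_one 2
    gcongr
  -- The powers of `l` combine to `l^{1/q}`, so `l N = (2 l F)^{1/q}`, and `2 l F ≤ 2 p l ≤ 1`.
  have hlN : l * N ≤ 1 := by
    have e : l * N = (l * (2 * F)) ^ (1 / q) := by
      rw [hN, mul_rpow hl0.le (by positivity), ← mul_assoc]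
      congr 1
      nth_rewrite 1 [← rpow_one l]
      rw [← rpow_add hl0]
      congr 1
      linarith
    rw [e]
    refine rpow_le_one (by positivity) ?_ (by positivity)
    nlinarith
  have h2pi : (2 * π) ^ (1 / q) ≤ 2 * π := by
    calc (2 * π) ^ (1 / q) ≤ (2 * π) ^ (1 : ℝ) :=
          rpow_le_rpow_of_exponent_le (by linarith [pi_gt_three]) hq1'
      _ = 2 * π := rpow_one _
  have hγ := fourteen_pi_sq_ge
  set γ := (14 * π) ^ 2
  have herr1 : 1 / π * ((2 * π * δ + (1 + π) * (2 * δ)) * N) ≤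
      P * (γ * (p ^ (1 / q) / (α * r) ^ (1 + 1 / p) * (1 / (n : ℝ) ^ r))) := by
    have e : P * (γ * (p ^ (1 / q) / (α * r) ^ (1 + 1 / p) * (1 / (n : ℝ) ^ r))) =
        γ * (δ * (P / A * p ^ (1 / q))) := by
      rw [rpow_add (by positivity), rpow_one, ← hA, hδ]
      field_simp
    rw [e]
    have h1 : 1 / π * ((2 * π * δ + (1 + π) * (2 * δ)) * N) = (4 + 2 / π) * (δ * N) := by
      field_simp
      ring
    have h2 : 2 / π ≤ 1 := by rw [div_le_one hpi]; linarith [pi_gt_three]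
    rw [h1]
    calc (4 + 2 / π) * (δ * N) ≤ (4 + 1) * (δ * (P / A * (2 * p ^ (1 / q)))) := by gcongr
      _ = 10 * (δ * (P / A * p ^ (1 / q))) := by ring
      _ ≤ γ * (δ * (P / A * p ^ (1 / q))) := by gcongr; linarith
  have herr2 : 1 / π * ((1 + π) * l * N + 120 * (2 * π) ^ (1 / q)) ≤
      P * (γ * ((1 + (α * r) ^ ((q - 1) / p) / (q - 1)) * (1 / P))) := by
    have e : P * (γ * ((1 + (α * r) ^ ((q - 1) / p) / (q - 1)) * (1 / P))) =
        γ * (1 + (α * r) ^ ((q - 1) / p) / (q - 1)) := by field_simp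
    rw [e]
    have h1 : 0 ≤ (α * r) ^ ((q - 1) / p) / (q - 1) :=
      div_nonneg (by positivity) (by linarith)
    -- `242` dominates `(1 + π)/π + 240`, where `240` is `120 · 2π / π`; it is far below `1764 = 42²
    -- ≤ (14π)²`.
    have h2 : 1 / π * ((1 + π) * l * N + 120 * (2 * π) ^ (1 / q)) ≤ 242 := by
      rw [one_div, inv_mul_le_iff₀ hpi]
      have : (1 + π) * l * N ≤ (1 + π) * 1 := by
        rw [mul_assoc]; gcongr
      nlinarith [pi_gt_three]
    nlinarith
  calc _ = 1 / π * (L / (2 * π) ^ (1 / q) * N) + 1 / π * ((2 * π * δ + (1 + π) * (2 * δ)) * N) +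
        1 / π * ((1 + π) * l * N + 120 * (2 * π) ^ (1 / q)) := by ring
    _ ≤ P * (L / (π ^ (1 + 1 / q) * A) * F ^ (1 / q)) +
        P * (γ * (p ^ (1 / q) / (α * r) ^ (1 + 1 / p) * (1 / (n : ℝ) ^ r))) +
        P * (γ * ((1 + (α * r) ^ ((q - 1) / p) / (q - 1)) * (1 / P))) :=
      add_le_add (add_le_add hmain.le herr1) herr2
    _ = _ := by ring

theorem one_div_pi_mul_tsum_tailCoeff_le {α r : ℝ} (hr0 : 0 < r) (hr1 : r < 1) (hα : 0 < α) {n : ℕ}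
    (hn : 1 ≤ n) (hδ : 1 / (α * r * (n : ℝ) ^ r) ≤ 1 / 2) :
    1 / π * ∑' j, tailCoeff α r n j ≤ (n : ℝ) ^ (1 - r) *
      (1 / (π * α * r) + (14 * π) ^ 2 *
        (1 / (α * r) ^ 2 * (1 / (n : ℝ) ^ r) + 1 / (n : ℝ) ^ (1 - r))) := by
  have hn0 : (0 : ℝ) < n := by exact_mod_cast hn
  have hpi := pi_pos
  have hS := tsum_tailCoeff_le hr0 hr1 hα hn hδ
  have e : (n : ℝ) ^ (r - 1) = ((n : ℝ) ^ (1 - r))⁻¹ := by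
    rw [← rpow_neg hn0.le]; congr 1; ring
  rw [e] at hS
  set P := (n : ℝ) ^ (1 - r)
  set R := (n : ℝ) ^ r
  have hP0 : 0 < P := by positivity
  have hR0 : 0 < R := by positivity
  have hγ := fourteen_pi_sq_ge
  set γ := (14 * π) ^ 2
  have h1 : 1 / π ≤ 1 := by rw [div_le_one hpi]; linarith [pi_gt_three]
  have h2 : 0 < P / ((α * r) ^ 2 * R) := by positivity
  calc 1 / π * ∑' j, tailCoeff α r n j
      ≤ 1 / π * (1 + 1 / (α * r * P⁻¹) * (1 + 2 * (1 / (α * r * R)))) := by gcongr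
    _ = P * (1 / (π * α * r)) + (1 / π) * 2 * (P / ((α * r) ^ 2 * R)) + 1 / π := by
      field_simp
      ring
    _ ≤ P * (1 / (π * α * r)) + γ * (P / ((α * r) ^ 2 * R)) + γ := by
      gcongr
      · linarith
      · linarith
    _ = _ := by field_simp; ring

end GenPoisson

end

theorem theorem1 (α r β : ℝ) (hr0 : 0 < r) (hr1 : r < 1) (hα : 0 < α) :
    ∃ γ : ℕ → ℝ → ℝ,
      (∀ (n : ℕ) (p : ℝ), |γ n p| ≤ (14 * π) ^ 2) ∧
      (∀ p p' : ℝ, 1 < p → 1 / p + 1 / p' = 1 →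
        ∀ n : ℕ, 1 ≤ n → GenPoisson.n₀ α r p ≤ n →
        ∀ f φ : ℝ → ℝ, GenPoisson.IsGenDeriv α r β p f φ →
          Continuous f ∧ Function.Periodic f (2 * π) ∧
          GenPoisson.uniformNorm (fun x => f x - GenPoisson.fourierSum (n - 1) f x) ≤
            exp (-α * (n : ℝ) ^ r) * (n : ℝ) ^ ((1 - r) / p) *
              (GenPoisson.lpNormPer p' cos / (π ^ (1 + 1 / p') * (α * r) ^ (1 / p)) *
                  (₂F₁ (1 / 2 : ℝ) ((3 - p') / 2) (3 / 2) (1 : ℝ)) ^ (1 / p') +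
                γ n p *
                  ((1 + (α * r) ^ ((p' - 1) / p) / (p' - 1)) * (1 / (n : ℝ) ^ ((1 - r) / p)) +
                    p ^ (1 / p') / (α * r) ^ (1 + 1 / p) * (1 / (n : ℝ) ^ r))) *
              GenPoisson.bestApprox n p φ) ∧
      (∀ n : ℕ, 1 ≤ n → GenPoisson.n₀ α r 1 ≤ n →
        ∀ f φ : ℝ → ℝ, GenPoisson.IsGenDeriv α r β 1 f φ →
          Continuous f ∧ Function.Periodic f (2 * π) ∧
          GenPoisson.uniformNorm (fun x => f x - GenPoisson.fourierSum (n - 1) f x) ≤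
            exp (-α * (n : ℝ) ^ r) * (n : ℝ) ^ (1 - r) *
              (1 / (π * α * r) +
                γ n 1 *
                  (1 / (α * r) ^ 2 * (1 / (n : ℝ) ^ r) + 1 / (n : ℝ) ^ (1 - r))) *
              GenPoisson.bestApprox n 1 φ) := by
  have hπ := pi_pos
  -- The factors multiplying `γ` are nonnegative, so the largest admissible constant serves for
  -- every `n` and `p`.
  refine ⟨fun _ _ => (14 * π) ^ 2, fun _ _ => (abs_of_nonneg (by positivity)).le, ?_, ?_⟩
  · intro p p' hp hpp n hn hn₀ f φ h
    have hpq : p.HolderConjugate p' := by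
      rw [Real.holderConjugate_iff]
      exact ⟨hp, by rwa [← one_div, ← one_div]⟩
    have hq := hpq.symm.lt
    have hn0 : (0 : ℝ) < n := by exact_mod_cast hn
    have hthr := GenPoisson.threshold_of_le hr0 hr1 hα hp.le hn₀
    rw [if_neg hp.ne'] at hthr
    -- Since `3π ≥ 9`, the threshold gives `δ` and `p l` at most `1/729`, ample for `l ≤ 1/8`, `δ ≤
    -- 1/2` and `2 p l ≤ 1`.
    have hsmall : 1 / (3 * π) ^ 3 * ((p - 1) / p) ≤ 1 / 729 := by
      have h1 : (p - 1) / p ≤ 1 := by rw [div_le_one (by linarith)]; linarith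
      have h2 : 1 / (3 * π) ^ 3 ≤ 1 / 729 := by
        refine one_div_le_one_div_of_le (by norm_num) ?_
        calc (729 : ℝ) = 9 ^ 3 := by norm_num
          _ ≤ (3 * π) ^ 3 := by gcongr; linarith [pi_gt_three]
      calc _ ≤ 1 / 729 * 1 := mul_le_mul h2 h1 (div_nonneg (by linarith) (by linarith)) (by norm_num)
        _ = _ := mul_one _
    set l := α * r * (n : ℝ) ^ (r - 1) with hl
    set δ := 1 / (α * r * (n : ℝ) ^ r) with hδ
    have hl0 : 0 < l := by positivity
    have hδ0 : 0 < δ := by positivity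
    have e1 : 1 / (α * r) * (1 / (n : ℝ) ^ r) = δ := by rw [hδ]; field_simp
    have e2 : α * r * p / (n : ℝ) ^ (1 - r) = p * l := by
      rw [hl, show r - 1 = -(1 - r) by ring, rpow_neg hn0.le]; field_simp
    rw [e1, e2] at hthr
    have hlp : p * l ≤ 1 / 729 := by linarith
    have hl1 : l ≤ 1 / 729 := by nlinarith
    have hpl0 : 0 < p * l := by positivity
    have hW := GenPoisson.lpNormPer_kernelTail_le β hr0 hr1 hα hn hl hδ (by linarith) (by linarith) hq
    have hpt := GenPoisson.one_div_pi_mul_tail_le hr0 hα hpq hn hl hδ (by linarith)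
    obtain ⟨g1, g2, g3⟩ := GenPoisson.uniformNorm_sub_fourierSum_le hr0 hr1 hα hp.le hn
      (GenPoisson.lpNormPer_nonneg p' (GenPoisson.kernelTail α r β n))
      (fun x ψ hψ => GenPoisson.abs_convolution_le hpq
        (GenPoisson.continuous_kernelTail β hr0 hr1 hα hn)
        (GenPoisson.periodic_kernelTail α r β n) hψ x) h
    refine ⟨g1, g2, g3.trans ?_⟩
    refine mul_le_mul_of_nonneg_right ?_ (GenPoisson.bestApprox_nonneg n p φ)
    rw [mul_assoc (exp _)]
    refine (mul_le_mul_of_nonneg_left hW (one_div_pos.mpr hπ).le).trans ?_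
    rw [mul_left_comm]
    exact mul_le_mul_of_nonneg_left hpt (exp_pos _).le
  · intro n hn hn₀ f φ h
    have hn0 : (0 : ℝ) < n := by exact_mod_cast hn
    have hthr := GenPoisson.threshold_of_le hr0 hr1 hα le_rfl hn₀
    rw [if_pos rfl] at hthr
    have hδ : 1 / (α * r * (n : ℝ) ^ r) ≤ 1 / 2 := by
      have e1 : 1 / (α * r) * (1 / (n : ℝ) ^ r) = 1 / (α * r * (n : ℝ) ^ r) := by field_simp
      rw [e1] at hthr
      have : 0 < α * r * 1 / (n : ℝ) ^ (1 - r) := by positivity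
      linarith
    have hpt := GenPoisson.one_div_pi_mul_tsum_tailCoeff_le hr0 hr1 hα hn hδ
    obtain ⟨g1, g2, g3⟩ := GenPoisson.uniformNorm_sub_fourierSum_le hr0 hr1 hα le_rfl hn
      (mul_nonneg (exp_pos _).le (tsum_nonneg fun j => (exp_pos _).le))
      (fun x ψ hψ => GenPoisson.abs_convolution_le_of_bound
        (GenPoisson.abs_kernelTail_le β hr0 hr1 hα hn) hψ x) h
    refine ⟨g1, g2, g3.trans ?_⟩
    refine mul_le_mul_of_nonneg_right ?_ (GenPoisson.bestApprox_nonneg n 1 φ)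
    rw [mul_assoc (exp _), mul_left_comm]
    exact mul_le_mul_of_nonneg_left hpt (exp_pos _).le
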